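/- Let $d\ge 1$ be an integer and $\alpha>d$ a real number. Let $(\xi(z))_{z\in\mathbb Z^d}$ be independent, identically distributed real random variables with the Pareto distribution $P(\xi(0)\le x)=1-x^{-\alpha}$ for $x\ge 1$. Consider the parabolic Anderson problem $$\partial_t u(t,z)=\sum_{y:\,|y-z|_1=1}\bigl[u(t,y)-u(t,z)\bigr]+\xi(z)\,u(t,z),\quad (t,z)\in(0,\infty)\times\mathbb Z^d,\qquad u(0,z)=\mathbf 1_{\{z=0\}},\quad z\in\mathbb Z^d ,$$ where a solution is required to satisfy $u(t,z)\to u(0,z)$ as $t\downarrow 0$ for each $z$. Almost surely this problem has exactly one nonnegative solution $u$. Its total mass $U(t)=\sum_{z\in\mathbb Z^d}u(t,z)$ is, almost surely, finite for all $t>0$, and $L_t:=\frac1t\log U(t)$ is, almost surely, positive for all $t>0$. Moreover, almost surely, $$\limsup_{t\to\infty}\frac{\log L_t-\frac{d}{\alpha-d}\log t}{\log\log t}=-\frac{d-1}{\alpha-d}\quad\text{if } d>1,$$ $$\limsup_{t\to\infty}\frac{\log L_t-\frac{d}{\alpha-d}\log t}{\log\log\log t}=\frac{1}{\alpha-d}\quad\text{if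 } d=1,$$ $$\liminf_{t\to\infty}\frac{\log L_t-\frac{d}{\alpha-d}\log t}{\log\log t}=-\frac{d}{\alpha-d}\quad\text{for all } d\ge 1,$$ and, as $t\to\infty$, $$\frac{\log L_t-\frac{d}{\alpha-d}\log t}{\log\log t}\;\Longrightarrow\;-\frac{d}{\alpha-d}\quad\text{in distribution.}$$ -/

import Mathlib

open MeasureTheory ProbabilityTheory Filter Topology

/-- The discrete Laplacian on `ℤ^d`: the sum of `f y - f z` over the `2d` nearest neighbours
`y = z + e_i` and `y = z - e_i` of `z`. -/
def latticeLaplacian {d : ℕ} (f : (Fin d → ℤ) → ℝ) (z : Fin d → ℤ) : ℝ :=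
  ∑ i : Fin d, ((f (z + Pi.single i 1) - f z) + (f (z - Pi.single i 1) - f z))

/-- `u` is a nonnegative solution of the Cauchy problem `∂ₜ u = Δ u + V u` on `(0, ∞) × ℤ^d` with
the localized initial condition `u(0, ·) = 1_0`. Only the values `u t z` for `t ≥ 0` matter. -/
structure IsNonnegPAMSolution {d : ℕ} (V : (Fin d → ℤ) → ℝ) (u : ℝ → (Fin d → ℤ) → ℝ) :
    Prop where
  nonneg : ∀ t : ℝ, 0 ≤ t → ∀ z, 0 ≤ u t z
  initial : ∀ z, u 0 z = if z = 0 then 1 else 0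
  continuous_zero : ∀ z, ContinuousWithinAt (fun t => u t z) (Set.Ici 0) 0
  equation : ∀ t : ℝ, 0 < t → ∀ z,
    HasDerivAt (fun s => u s z) (latticeLaplacian (u t) z + V z * u t z) t

/-- The total mass `U(t) = ∑_z u(t, z)`. -/
noncomputable def totalMass {d : ℕ} (u : ℝ → (Fin d → ℤ) → ℝ) (t : ℝ) : ℝ :=
  ∑' z, u t z

/-- `L_t = (1 / t) log U(t)`. -/
noncomputable def logMassRate {d : ℕ} (u : ℝ → (Fin d → ℤ) → ℝ) (t : ℝ) : ℝ :=
  (1 / t) * Real.log (totalMass u t)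

/-! The heuristic is a one-site variational problem. In the Feynman–Kac picture the mass at times `t
∈ [T, 2T]` comes from paths that travel to a site `z` of large potential and stay there. Travelling
costs about `|z| log T / T` per unit of time, so a level `x` is useful only within distance of order
`x T / log T`. The expected number of sites there with potential above `x` is of order `(T / log
T)^d x^(-(α - d))`, which equals one at `x = (T / log T)^β` with `β = d / (α - d)`. This is
`levelScale β T`, and the problem reduces to the fluctuations of the factor `Λ` in `L_t ≈ levelScale
β T * Λ`.

Two deterministic bounds make this precise. If `V z ≤ A + B |z|`, a path with `n` jumps sees a
potential of at most `A + B n`; summing over `n` gives `L_t ≤ A + 2 d e^(B t)`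
(`HasLinearGrowth.logMassRate_le`), and a slope `B` of order `log T / T` keeps the second term below
`levelScale β T`. Conversely, going to one good site and waiting there bounds `L_t` from below
(`HasLinearGrowth.site_le_logMassRate`). Constant factors are harmless after taking logarithms.

Two probabilities remain. The field exceeds the cone of height `levelScale β T * Λ` with probability
at most `C Λ^(-(α - d))`, and it stays below that level on the reachable cube with probability at
most `exp (-c Λ^(-(α - d)))`. There are about `log T` dyadic scales up to `T`. By Borel–Cantelli the
largest `Λ^(α - d)` seen at scale `j` is `j log j` up to powers of `log j` arbitrarily close to the
first, so `log Λ` reaches `(log log t + log log log t) / (α - d)`. Added to `-β log log t` this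
gives `-(d - 1) / (α - d)`; for `d = 1` the `log log t` terms cancel and the `log log log t` term
decides. Small `Λ` is so unlikely that `log Λ` never falls below order `-log log log t`, while with
probability tending to one `Λ ≤ (log T)^ε`. This gives the liminf and the limit in distribution.

Existence and uniqueness hold for every nonnegative potential of linear growth. The expansion over
numbers of jumps is the minimal solution; a second solution exceeds it by a nonnegative evolution
started from zero, which vanishes by `IsNonnegEvolution.eq_zero`. -/

/-- The `ℓ¹`-norm on `ℤ^d`, as a natural number. -/
def latticeNorm {d : ℕ} (z : Fin d → ℤ) : ℕ := ∑ i, (z i).natAbs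

/-- The sum of the values of a function over the `2d` nearest neighbours, as a linear operator. -/
def neighborSum (d : ℕ) : Module.End ℝ ((Fin d → ℤ) → ℝ) where
  toFun f z := ∑ i : Fin d, (f (z + Pi.single i 1) + f (z - Pi.single i 1))
  map_add' f g := by
    funext z
    simp only [Pi.add_apply, ← Finset.sum_add_distrib]
    exact Finset.sum_congr rfl fun i _ => by ring
  map_smul' c f := by
    funext z
    simp only [Pi.smul_apply, smul_eq_mul, RingHom.id_apply, Finset.mul_sum]
    exact Finset.sum_congr rfl fun i _ => by ring

/-! ### Walks on the lattice and powers of the neighbour sum. -/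

section Lattice

variable {d : ℕ}

lemma neighborSum_apply (f : (Fin d → ℤ) → ℝ) (z : Fin d → ℤ) :
    neighborSum d f z = ∑ i : Fin d, (f (z + Pi.single i 1) + f (z - Pi.single i 1)) := rfl

lemma latticeLaplacian_eq (f : (Fin d → ℤ) → ℝ) (z : Fin d → ℤ) :
    latticeLaplacian f z = neighborSum d f z - 2 * d * f z := by
  simp only [latticeLaplacian, neighborSum_apply, Finset.sum_add_distrib, Finset.sum_sub_distrib,
    Finset.sum_const, Finset.card_univ, Fintype.card_fin, nsmul_eq_mul]
  ring

lemma latticeNorm_add_le (x y : Fin d → ℤ) : latticeNorm (x + y) ≤ latticeNorm x + latticeNorm y := by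
  simp only [latticeNorm, ← Finset.sum_add_distrib]
  exact Finset.sum_le_sum fun i _ => Int.natAbs_add_le _ _

@[simp] lemma latticeNorm_neg (x : Fin d → ℤ) : latticeNorm (-x) = latticeNorm x := by
  simp [latticeNorm]

@[simp] lemma latticeNorm_single (i : Fin d) (k : ℤ) :
    latticeNorm (Pi.single i k : Fin d → ℤ) = k.natAbs := by
  rw [latticeNorm, Finset.sum_eq_single i]
  · simp
  · intro j _ hj; simp [Pi.single_eq_of_ne hj]
  · simp

@[simp] lemma latticeNorm_eq_zero {x : Fin d → ℤ} : latticeNorm x = 0 ↔ x = 0 := by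
  simp [latticeNorm, Finset.sum_eq_zero_iff, funext_iff]

/-- A nonzero lattice vector has a neighbour closer to the origin. -/
lemma exists_latticeNorm_succ {x : Fin d → ℤ} {n : ℕ} (h : latticeNorm x = n + 1) :
    ∃ i, latticeNorm (x - Pi.single i 1) = n ∨ latticeNorm (x + Pi.single i 1) = n := by
  obtain ⟨i, hi⟩ : ∃ i, x i ≠ 0 := by
    by_contra! hx
    have : x = 0 := funext hx
    simp [this, latticeNorm] at h
  have key : ∀ y : Fin d → ℤ, (∀ j, j ≠ i → y j = x j) → (y i).natAbs + 1 = (x i).natAbs →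
      latticeNorm y = n := by
    intro y hy hyi
    have h1 := Finset.add_sum_erase Finset.univ (fun j => (x j).natAbs) (Finset.mem_univ i)
    have h2 := Finset.add_sum_erase Finset.univ (fun j => (y j).natAbs) (Finset.mem_univ i)
    have h3 : ∑ j ∈ Finset.univ.erase i, (y j).natAbs = ∑ j ∈ Finset.univ.erase i, (x j).natAbs :=
      Finset.sum_congr rfl fun j hj => by rw [hy j (Finset.ne_of_mem_erase hj)]
    simp only [latticeNorm] at h ⊢
    omega
  refine ⟨i, ?_⟩
  rcases lt_or_gt_of_ne hi with hneg | hpos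
  · right
    refine key _ (fun j hj => by simp [Pi.single_eq_of_ne hj]) ?_
    simp only [Pi.add_apply, Pi.single_eq_same]
    omega
  · left
    refine key _ (fun j hj => by simp [Pi.single_eq_of_ne hj]) ?_
    simp only [Pi.sub_apply, Pi.single_eq_same]
    omega

lemma neighborSum_pow_succ_apply (n : ℕ) (f : (Fin d → ℤ) → ℝ) :
    (neighborSum d ^ (n + 1)) f = neighborSum d ((neighborSum d ^ n) f) := by
  rw [pow_succ']; rfl

lemma neighborSum_pow_succ_apply' (n : ℕ) (f : (Fin d → ℤ) → ℝ) :
    (neighborSum d ^ (n + 1)) f = (neighborSum d ^ n) (neighborSum d f) := by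
  rw [pow_succ]; rfl

/-- Monotonicity of the powers of `neighborSum`, in local form. -/
lemma neighborSum_pow_mono {n : ℕ} {f g : (Fin d → ℤ) → ℝ} {x : Fin d → ℤ}
    (h : ∀ z, latticeNorm (z - x) ≤ n → f z ≤ g z) :
    (neighborSum d ^ n) f x ≤ (neighborSum d ^ n) g x := by
  induction n generalizing x with
  | zero => simpa using h x (by simp)
  | succ n ih =>
    simp only [neighborSum_pow_succ_apply, neighborSum_apply]
    refine Finset.sum_le_sum fun i _ => add_le_add (ih fun z hz => h z ?_) (ih fun z hz => h z ?_)
    · have := latticeNorm_add_le (z - (x + Pi.single i 1)) (Pi.single i 1)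
      rw [show z - (x + Pi.single i 1) + Pi.single i 1 = z - x by abel] at this
      simp only [latticeNorm_single, Int.natAbs_one] at this
      omega
    · have := latticeNorm_add_le (z - (x - Pi.single i 1)) (-(Pi.single i 1 : Fin d → ℤ))
      rw [show z - (x - Pi.single i 1) + -(Pi.single i 1 : Fin d → ℤ) = z - x by abel] at this
      simp only [latticeNorm_neg, latticeNorm_single, Int.natAbs_one] at this
      omega

lemma neighborSum_pow_nonneg {f : (Fin d → ℤ) → ℝ} (hf : ∀ z, 0 ≤ f z) (n : ℕ) (x : Fin d → ℤ) :
    0 ≤ (neighborSum d ^ n) f x := by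
  have := neighborSum_pow_mono (n := n) (f := 0) (g := f) (x := x) fun z _ => hf z
  simpa using this

lemma neighborSum_mono {f g : (Fin d → ℤ) → ℝ} (h : ∀ z, f z ≤ g z) (x : Fin d → ℤ) :
    neighborSum d f x ≤ neighborSum d g x := by
  have := neighborSum_pow_mono (n := 1) (f := f) (g := g) (x := x) fun z _ => h z
  simpa using this

lemma neighborSum_nonneg {f : (Fin d → ℤ) → ℝ} (hf : ∀ z, 0 ≤ f z) (x : Fin d → ℤ) :
    0 ≤ neighborSum d f x := by
  simpa using neighborSum_pow_nonneg hf 1 x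

/-- The `n`-th power sums `f` over endpoints of `n`-step walks from `x`, and at least one such walk
is a shortest path to `z`. -/
lemma le_neighborSum_pow {f : (Fin d → ℤ) → ℝ} (hf : ∀ z, 0 ≤ f z) {n : ℕ} {x z : Fin d → ℤ}
    (h : latticeNorm (x - z) = n) : f z ≤ (neighborSum d ^ n) f x := by
  induction n generalizing x with
  | zero =>
    rw [latticeNorm_eq_zero, sub_eq_zero] at h
    simp [h]
  | succ n ih =>
    obtain ⟨i, hi⟩ := exists_latticeNorm_succ h
    rw [neighborSum_pow_succ_apply, neighborSum_apply]
    have hnn := neighborSum_pow_nonneg hf n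
    refine le_trans ?_ (Finset.single_le_sum
      (f := fun i : Fin d => (neighborSum d ^ n) f (x + Pi.single i 1) +
        (neighborSum d ^ n) f (x - Pi.single i 1))
      (fun j _ => add_nonneg (hnn _) (hnn _)) (Finset.mem_univ i))
    rcases hi with hi | hi
    · refine (ih (x := x - Pi.single i 1) ?_).trans (le_add_of_nonneg_left (hnn _))
      rwa [show x - Pi.single i 1 - z = x - z - Pi.single i 1 by abel]
    · refine (ih (x := x + Pi.single i 1) ?_).trans (le_add_of_nonneg_right (hnn _))
      rwa [show x + Pi.single i 1 - z = x - z + Pi.single i 1 by abel]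

lemma hasSum_neighborSum {f : (Fin d → ℤ) → ℝ} {a : ℝ} (h : HasSum f a) :
    HasSum (neighborSum d f) (2 * d * a) := by
  have h1 : HasSum (fun z : Fin d → ℤ => ∑ i : Fin d, (f (z + Pi.single i 1) + f (z - Pi.single i 1)))
      (∑ _i : Fin d, (a + a)) := by
    refine hasSum_sum fun i _ => HasSum.add ?_ ?_
    · exact (Equiv.addRight (Pi.single i 1 : Fin d → ℤ)).hasSum_iff.2 h
    · exact (Equiv.subRight (Pi.single i 1 : Fin d → ℤ)).hasSum_iff.2 h
  have h2 : ∑ _i : Fin d, (a + a) = 2 * d * a := by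
    rw [Finset.sum_const, Finset.card_univ, Fintype.card_fin, nsmul_eq_mul]
    ring
  exact h2 ▸ h1

lemma hasDerivAt_neighborSum_pow {f : ℝ → (Fin d → ℤ) → ℝ} {f' : (Fin d → ℤ) → ℝ} {t : ℝ}
    (h : ∀ z, HasDerivAt (fun s => f s z) (f' z) t) (n : ℕ) (z : Fin d → ℤ) :
    HasDerivAt (fun s => (neighborSum d ^ n) (f s) z) ((neighborSum d ^ n) f' z) t := by
  induction n generalizing z with
  | zero => simpa using h z
  | succ n ih =>
    simp only [neighborSum_pow_succ_apply, neighborSum_apply]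
    exact HasDerivAt.fun_sum fun i _ => (ih _).add (ih _)

lemma continuousWithinAt_neighborSum_pow {f : ℝ → (Fin d → ℤ) → ℝ} {t : ℝ} {s : Set ℝ}
    (h : ∀ z, ContinuousWithinAt (fun s => f s z) s t) (n : ℕ) (z : Fin d → ℤ) :
    ContinuousWithinAt (fun s => (neighborSum d ^ n) (f s) z) s t := by
  induction n generalizing z with
  | zero => simpa using h z
  | succ n ih =>
    simp only [neighborSum_pow_succ_apply, neighborSum_apply]
    exact tendsto_finsetSum _ fun i _ => (ih _).add (ih _)

end Lattice

/-! ### Scalar comparison and the kernels `e^{ct} t^m / m!`. -/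

/-- A comparison principle for scalar linear differential inequalities. -/
lemma nonpos_of_deriv_le_mul {f f' : ℝ → ℝ} {a b c : ℝ} (hab : a ≤ b)
    (hcont : ContinuousOn f (Set.Icc a b))
    (hderiv : ∀ t ∈ Set.Ioo a b, HasDerivAt f (f' t) t)
    (hle : ∀ t ∈ Set.Ioo a b, f' t ≤ c * f t) (ha : f a ≤ 0) : f b ≤ 0 := by
  -- With the integrating factor `e^{-ct}` the inequality says that a function is nonincreasing.
  have hd : ∀ t ∈ Set.Ioo a b,
      HasDerivAt (fun s => f s * Real.exp (-c * s)) ((f' t - c * f t) * Real.exp (-c * t)) t := by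
    intro t ht
    have h1 : HasDerivAt (fun s : ℝ => Real.exp (-c * s)) (Real.exp (-c * t) * (-c)) t := by
      simpa using ((hasDerivAt_id t).const_mul (-c)).exp
    exact ((hderiv t ht).mul h1).congr_deriv (by ring)
  have hanti : AntitoneOn (fun s => f s * Real.exp (-c * s)) (Set.Icc a b) := by
    refine antitoneOn_of_deriv_nonpos (convex_Icc a b)
      (hcont.mul (by fun_prop)) ?_ ?_
    · intro t ht
      rw [interior_Icc] at ht
      exact (hd t ht).differentiableAt.differentiableWithinAt
    · intro t ht
      rw [interior_Icc] at ht
      rw [(hd t ht).deriv]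
      exact mul_nonpos_of_nonpos_of_nonneg (sub_nonpos.2 (hle t ht)) (Real.exp_pos _).le
  have h2 := hanti (Set.left_mem_Icc.2 hab) (Set.right_mem_Icc.2 hab) hab
  have h3 : f b * Real.exp (-c * b) ≤ 0 :=
    h2.trans (mul_nonpos_of_nonpos_of_nonneg ha (Real.exp_pos _).le)
  by_contra! hb
  exact absurd h3 (not_le.2 (mul_pos hb (Real.exp_pos _)))

/-- The function `t ↦ e^{c t} t^m / m!`. -/
noncomputable def expMonomial (c : ℝ) (m : ℕ) (t : ℝ) : ℝ :=
  Real.exp (c * t) * (t ^ m / m.factorial)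

lemma expMonomial_nonneg (c : ℝ) (m : ℕ) {t : ℝ} (ht : 0 ≤ t) : 0 ≤ expMonomial c m t := by
  unfold expMonomial; positivity

@[simp] lemma expMonomial_zero_right (c : ℝ) (m : ℕ) :
    expMonomial c m 0 = if m = 0 then 1 else 0 := by
  rcases m with _ | m <;> simp [expMonomial]

lemma hasDerivAt_exp_mul (c t : ℝ) :
    HasDerivAt (fun s : ℝ => Real.exp (c * s)) (c * Real.exp (c * t)) t := by
  have := ((hasDerivAt_id t).const_mul c).exp
  simpa [mul_comm] using this

lemma hasDerivAt_expMonomial_zero (c t : ℝ) :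
    HasDerivAt (expMonomial c 0) (c * expMonomial c 0 t) t := by
  have h : expMonomial c 0 = fun s => Real.exp (c * s) := by
    funext s; simp [expMonomial]
  rw [h]
  exact hasDerivAt_exp_mul c t

lemma hasDerivAt_expMonomial_succ (c : ℝ) (m : ℕ) (t : ℝ) :
    HasDerivAt (expMonomial c (m + 1))
      (c * expMonomial c (m + 1) t + expMonomial c m t) t := by
  have h := (hasDerivAt_exp_mul c t).mul
    ((hasDerivAt_pow (m + 1) t).div_const ((m + 1).factorial : ℝ))
  refine h.congr_deriv ?_
  have h1 : ((m : ℝ) + 1) ≠ 0 := by positivity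
  have h2 : (m.factorial : ℝ) ≠ 0 := by positivity
  simp only [expMonomial, Nat.factorial_succ, Nat.cast_mul, Nat.cast_add, Nat.cast_one,
    Nat.add_sub_cancel]
  field_simp

lemma continuous_expMonomial (c : ℝ) (m : ℕ) : Continuous (expMonomial c m) := by
  unfold expMonomial; fun_prop

lemma hasSum_expMonomial_mul_pow (c b t : ℝ) :
    HasSum (fun n => expMonomial c n t * b ^ n) (Real.exp (c * t + b * t)) := by
  have h := (NormedSpace.expSeries_div_hasSum_exp (𝔸 := ℝ) (b * t)).mul_left (Real.exp (c * t))
  rw [← Real.exp_eq_exp_ℝ, ← Real.exp_add] at h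
  refine h.congr_fun fun n => ?_
  simp only [expMonomial, mul_pow]
  ring

/-! ### Nonnegative evolutions and their vanishing from zero initial data. -/

/-- Nonnegative functions on `[0, ∞) × ℤ^d` solving `∂ₜ h = Δ h + V h` for `t > 0`, with arbitrary
initial values. -/
structure IsNonnegEvolution {d : ℕ} (V : (Fin d → ℤ) → ℝ) (h : ℝ → (Fin d → ℤ) → ℝ) :
    Prop where
  nonneg : ∀ t : ℝ, 0 ≤ t → ∀ z, 0 ≤ h t z
  continuous_zero : ∀ z, ContinuousWithinAt (fun t => h t z) (Set.Ici 0) 0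
  equation : ∀ t : ℝ, 0 < t → ∀ z,
    HasDerivAt (fun s => h s z) (neighborSum d (h t) z + (V z - 2 * d) * h t z) t

section Evolution

variable {d : ℕ} {V : (Fin d → ℤ) → ℝ} {h : ℝ → (Fin d → ℤ) → ℝ}

lemma IsNonnegPAMSolution.isNonnegEvolution {u : ℝ → (Fin d → ℤ) → ℝ}
    (hu : IsNonnegPAMSolution V u) : IsNonnegEvolution V u where
  nonneg := hu.nonneg
  continuous_zero := hu.continuous_zero
  equation t ht z := (hu.equation t ht z).congr_deriv (by rw [latticeLaplacian_eq]; ring)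

lemma IsNonnegEvolution.continuousOn (H : IsNonnegEvolution V h) (z : Fin d → ℤ) :
    ContinuousOn (fun t => h t z) (Set.Ici 0) := by
  intro t ht
  rcases eq_or_lt_of_le (Set.mem_Ici.1 ht) with rfl | ht
  · exact H.continuous_zero z
  · exact (H.equation t ht z).continuousAt.continuousWithinAt

lemma IsNonnegEvolution.continuousOn_pow (H : IsNonnegEvolution V h) (n : ℕ) (z : Fin d → ℤ) :
    ContinuousOn (fun t => (neighborSum d ^ n) (h t) z) (Set.Ici 0) := fun t ht =>
  continuousWithinAt_neighborSum_pow (fun z => H.continuousOn z t ht) n z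

lemma IsNonnegEvolution.hasDerivAt_pow (H : IsNonnegEvolution V h) (n : ℕ) (x : Fin d → ℤ)
    {t : ℝ} (ht : 0 < t) :
    HasDerivAt (fun s => (neighborSum d ^ n) (h s) x)
      ((neighborSum d ^ (n + 1)) (h t) x
        + (neighborSum d ^ n) (fun z => (V z - 2 * d) * h t z) x) t := by
  refine (hasDerivAt_neighborSum_pow (H.equation t ht) n x).congr_deriv ?_
  rw [neighborSum_pow_succ_apply', ← Pi.add_apply, ← map_add]
  rfl

/-- Lower bound for a nonnegative evolution with nonnegative potential in terms of the values at an
earlier time. -/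
lemma IsNonnegEvolution.expMonomial_mul_le (H : IsNonnegEvolution V h) (hV : ∀ z, 0 ≤ V z)
    {s : ℝ} (hs : 0 ≤ s) (x : Fin d → ℤ) (m j : ℕ) {r : ℝ} (hr : s ≤ r) :
    expMonomial (-(2 * d)) m (r - s) * (neighborSum d ^ (j + m)) (h s) x
      ≤ (neighborSum d ^ j) (h r) x := by
  induction m generalizing j r with
  | zero =>
    rw [← sub_nonpos]
    refine nonpos_of_deriv_le_mul (c := -(2 * d)) (a := s) (b := r)
      (f := fun r => expMonomial (-(2 * d)) 0 (r - s) * (neighborSum d ^ (j + 0)) (h s) x -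
        (neighborSum d ^ j) (h r) x) hr ?_
      (fun t ht => (((hasDerivAt_expMonomial_zero _ _).comp_sub_const t s).mul_const _).sub
        (H.hasDerivAt_pow j x (hs.trans_lt ht.1))) ?_ ?_
    · exact (((continuous_expMonomial _ _).comp (by fun_prop)).mul continuous_const).continuousOn.sub
        ((H.continuousOn_pow j x).mono fun t ht => hs.trans ht.1)
    · intro t ht
      have ht0 := hs.trans_lt ht.1
      have h1 := neighborSum_pow_nonneg (H.nonneg t ht0.le) (j + 1) x
      have h2 : -(2 * d) * (neighborSum d ^ j) (h t) x
          ≤ (neighborSum d ^ j) (fun z => (V z - 2 * d) * h t z) x := by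
        rw [← smul_eq_mul, ← Pi.smul_apply, ← map_smul]
        refine neighborSum_pow_mono fun z _ => ?_
        rw [Pi.smul_apply, smul_eq_mul]
        nlinarith [hV z, H.nonneg t ht0.le z]
      linarith
    · simp
  | succ m ih =>
    rw [← sub_nonpos]
    refine nonpos_of_deriv_le_mul (c := -(2 * d)) (a := s) (b := r)
      (f := fun r => expMonomial (-(2 * d)) (m + 1) (r - s) *
        (neighborSum d ^ (j + (m + 1))) (h s) x - (neighborSum d ^ j) (h r) x) hr ?_
      (fun t ht => (((hasDerivAt_expMonomial_succ _ _ _).comp_sub_const t s).mul_const _).sub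
        (H.hasDerivAt_pow j x (hs.trans_lt ht.1))) ?_ ?_
    · exact (((continuous_expMonomial _ _).comp (by fun_prop)).mul continuous_const).continuousOn.sub
        ((H.continuousOn_pow j x).mono fun t ht => hs.trans ht.1)
    · intro t ht
      have ht0 := hs.trans_lt ht.1
      -- The inflow from the neighbours is the `(j + 1)`-st power, bounded below by induction;
      -- integrating it yields one more power of time.
      have h1 := ih (j + 1) ht.1.le
      rw [show j + 1 + m = j + (m + 1) by ring] at h1
      have h2 : -(2 * d) * (neighborSum d ^ j) (h t) x
          ≤ (neighborSum d ^ j) (fun z => (V z - 2 * d) * h t z) x := by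
        rw [← smul_eq_mul, ← Pi.smul_apply, ← map_smul]
        refine neighborSum_pow_mono fun z _ => ?_
        rw [Pi.smul_apply, smul_eq_mul]
        nlinarith [hV z, H.nonneg t ht0.le z]
      linarith
    · simpa using neighborSum_pow_nonneg (H.nonneg s hs) j x

lemma IsNonnegEvolution.expMonomial_mul_apply_le (H : IsNonnegEvolution V h) (hV : ∀ z, 0 ≤ V z)
    {s r : ℝ} (hs : 0 ≤ s) (hr : s ≤ r) (x z : Fin d → ℤ) :
    expMonomial (-(2 * d)) (latticeNorm (x - z)) (r - s) * h s z ≤ h r x := by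
  have h1 := H.expMonomial_mul_le hV hs x (latticeNorm (x - z)) 0 hr
  rw [zero_add, pow_zero] at h1
  exact (mul_le_mul_of_nonneg_left (le_neighborSum_pow (H.nonneg s hs) rfl)
    (expMonomial_nonneg _ _ (sub_nonneg.2 hr))).trans h1

/-- A nonnegative evolution grows at least at the rate `V x - 2 d` at the site `x`. -/
lemma IsNonnegEvolution.exp_mul_le (H : IsNonnegEvolution V h) {s r : ℝ} (hs : 0 ≤ s)
    (hr : s ≤ r) (x : Fin d → ℤ) :
    Real.exp ((V x - 2 * d) * (r - s)) * h s x ≤ h r x := by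
  rw [← sub_nonpos]
  refine nonpos_of_deriv_le_mul (c := V x - 2 * d) (a := s) (b := r)
    (f := fun r => Real.exp ((V x - 2 * d) * (r - s)) * h s x - h r x) hr ?_
    (fun t ht => (((hasDerivAt_exp_mul _ _).comp_sub_const t s).mul_const _).sub
      (H.equation t (hs.trans_lt ht.1) x)) ?_ ?_
  · exact (by fun_prop : Continuous fun r =>
      Real.exp ((V x - 2 * d) * (r - s)) * h s x).continuousOn.sub
      ((H.continuousOn x).mono fun t ht => hs.trans ht.1)
  · intro t ht
    have ht0 := hs.trans_lt ht.1
    have h1 := neighborSum_nonneg (H.nonneg t ht0.le) x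
    linarith
  · simp

/-- Upper bound for a nonnegative evolution started from zero in terms of its values at distance at
most `n`. -/
lemma IsNonnegEvolution.pow_le_expMonomial_mul (H : IsNonnegEvolution V h)
    (h0 : ∀ z, h 0 z = 0) {n : ℕ} {c K t : ℝ} (hc : 0 ≤ c) (hK0 : 0 ≤ K)
    (hV : ∀ z, latticeNorm z ≤ n → V z - 2 * d ≤ c)
    (hK : ∀ s ∈ Set.Icc 0 t, (neighborSum d ^ n) (h s) 0 ≤ K) (m j : ℕ) (hmj : j + m = n)
    {s : ℝ} (hs : s ∈ Set.Icc 0 t) :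
    (neighborSum d ^ j) (h s) 0 ≤ expMonomial c m s * K := by
  induction m generalizing j s with
  | zero =>
    obtain rfl : j = n := hmj
    refine (hK s hs).trans (le_mul_of_one_le_left hK0 ?_)
    simpa [expMonomial] using mul_nonneg hc hs.1
  | succ m ih =>
    rw [← sub_nonpos]
    refine nonpos_of_deriv_le_mul (c := c) (a := 0) (b := s)
      (f := fun r => (neighborSum d ^ j) (h r) 0 - expMonomial c (m + 1) r * K) hs.1 ?_
      (fun r hr => (H.hasDerivAt_pow j 0 hr.1).sub
        ((hasDerivAt_expMonomial_succ _ _ _).mul_const _)) ?_ ?_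
    · exact ((H.continuousOn_pow j 0).mono fun r hr => hr.1).sub
        ((continuous_expMonomial _ _).mul continuous_const).continuousOn
    · intro r hr
      have h1 := ih (j + 1) (by omega) (s := r) ⟨hr.1.le, hr.2.le.trans hs.2⟩
      have h2 : (neighborSum d ^ j) (fun z => (V z - 2 * d) * h r z) 0
          ≤ c * (neighborSum d ^ j) (h r) 0 := by
        rw [← smul_eq_mul c, ← Pi.smul_apply c, ← map_smul]
        -- The `j`-th power at the origin involves only sites within distance `j ≤ n`, where the
        -- bound on `V` is available.
        refine neighborSum_pow_mono fun z hz => ?_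
        rw [Pi.smul_apply, smul_eq_mul]
        rw [sub_zero] at hz
        exact mul_le_mul_of_nonneg_right (hV z (by omega)) (H.nonneg r hr.1.le z)
      linarith
    · have : h 0 = 0 := funext h0
      simp [this]

/-- A nonnegative evolution with zero initial value vanishes, when the potential is nonnegative and
grows at most linearly. -/
lemma IsNonnegEvolution.eq_zero (H : IsNonnegEvolution V h) (h0 : ∀ z, h 0 z = 0) {A B : ℝ}
    (hA : 0 ≤ A) (hB : 0 ≤ B) (hV0 : ∀ z, 0 ≤ V z) (hV : ∀ z, V z ≤ A + B * latticeNorm z)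
    {t : ℝ} (ht : 0 ≤ t) (z : Fin d → ℤ) : h t z = 0 := by
  have key : ∀ t : ℝ, 0 < t → h t 0 = 0 := by
    intro t ht
    -- Looking ahead by time `q` bounds the `n`-th power at the origin by a multiple of `n! / q^n`;
    -- the zero initial value contributes `e^{(A + B n) t} t^n / n!`. The product is of order `(t
    -- e^{Bt} / q)^n`, and this `q` makes the ratio `1/2`.
    set q : ℝ := 2 * t * Real.exp (B * t) with hq
    have hqpos : 0 < q := by positivity
    have hbound : ∀ n : ℕ, h t 0 ≤ (Real.exp (A * t) * (Real.exp (2 * d * (t + q)) *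
        h (t + q) 0)) * (1 / 2) ^ n := by
      intro n
      have hT0 : 0 ≤ h (t + q) 0 := H.nonneg _ (by positivity) 0
      have hK : ∀ s ∈ Set.Icc 0 t, (neighborSum d ^ n) (h s) 0
          ≤ Real.exp (2 * d * (t + q)) * (n.factorial / q ^ n) * h (t + q) 0 := by
        intro s hs
        have h1 := H.expMonomial_mul_le hV0 hs.1 0 n 0 (r := t + q) (by linarith [hs.2])
        rw [zero_add, pow_zero] at h1
        have h2 : Real.exp (-(2 * d * (t + q))) * (q ^ n / n.factorial)
            ≤ expMonomial (-(2 * d)) n (t + q - s) := by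
          unfold expMonomial
          have hsq : q ≤ t + q - s := by linarith [hs.2]
          refine mul_le_mul (Real.exp_le_exp.2 ?_) ?_ (by positivity) (by positivity)
          · have : (0 : ℝ) ≤ 2 * d * s := mul_nonneg (by positivity) hs.1
            linarith
          · gcongr
        have h3 := (mul_le_mul_of_nonneg_right h2
          (neighborSum_pow_nonneg (H.nonneg s hs.1) n 0)).trans h1
        rw [Real.exp_neg] at h3
        have h4 : (neighborSum d ^ n) (h s) 0 = Real.exp (2 * d * (t + q)) * (n.factorial / q ^ n)
          * ((Real.exp (2 * d * (t + q)))⁻¹ * (q ^ n / n.factorial) *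
            (neighborSum d ^ n) (h s) 0) := by
          have : (n.factorial : ℝ) ≠ 0 := by positivity
          field_simp
        rw [h4]
        exact mul_le_mul_of_nonneg_left h3 (by positivity)
      have h5 := H.pow_le_expMonomial_mul h0 (n := n) (c := A + B * n) (t := t)
        (by positivity) (by positivity) (fun z hz => ?_) hK n 0 (by simp) ⟨ht.le, le_rfl⟩
      · refine h5.trans (le_of_eq ?_)
        have e1 : Real.exp ((A + B * n) * t) = Real.exp (A * t) * Real.exp (B * t) ^ n := by
          rw [← Real.exp_nat_mul, ← Real.exp_add]; ring_nf
        have e2 : q ^ n = 2 ^ n * t ^ n * Real.exp (B * t) ^ n := by rw [hq, mul_pow, mul_pow]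
        have : (n.factorial : ℝ) ≠ 0 := by positivity
        rw [expMonomial, e1, e2, one_div, inv_pow]
        field_simp
      · have h6 : B * (latticeNorm z : ℝ) ≤ B * n :=
          mul_le_mul_of_nonneg_left (by exact_mod_cast hz) hB
        have h7 : (0 : ℝ) ≤ 2 * d := by positivity
        linarith [hV z]
    have hlim : Tendsto (fun n : ℕ => (Real.exp (A * t) * (Real.exp (2 * d * (t + q)) *
        h (t + q) 0)) * (1 / 2) ^ n) atTop (𝓝 0) := by
      simpa using (tendsto_pow_atTop_nhds_zero_of_lt_one (r := (1 / 2 : ℝ))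
        (by norm_num) (by norm_num)).const_mul _
    exact le_antisymm (ge_of_tendsto' hlim hbound) (H.nonneg t ht.le 0)
  -- A positive value at `(t, z)` would spread to a positive value at the origin at time `t + 1`.
  have h1 := H.expMonomial_mul_apply_le hV0 ht (r := t + 1) (by linarith) 0 z
  rw [key (t + 1) (by linarith), add_sub_cancel_left] at h1
  have h2 : 0 < expMonomial (-(2 * d)) (latticeNorm (0 - z)) 1 := by
    unfold expMonomial; positivity
  exact le_antisymm (nonpos_of_mul_nonpos_right h1 h2) (H.nonneg t ht z)

end Evolution

/-! ### The expansion over the number of jumps. -/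

/-- The contribution of the paths with exactly `n` jumps to the minimal nonnegative solution. -/
noncomputable def pathTerm {d : ℕ} (V : (Fin d → ℤ) → ℝ) : ℕ → ℝ → (Fin d → ℤ) → ℝ
  | 0, t, z => Real.exp ((V z - 2 * d) * t) * (Pi.single 0 1 : (Fin d → ℤ) → ℝ) z
  | n + 1, t, z => Real.exp ((V z - 2 * d) * t) *
      ∫ s in (0 : ℝ)..t, Real.exp (-(V z - 2 * d) * s) * neighborSum d (pathTerm V n s) z

/-- The minimal nonnegative solution, as the sum of the contributions of all numbers of jumps. -/
noncomputable def pathSolution {d : ℕ} (V : (Fin d → ℤ) → ℝ) (t : ℝ) (z : Fin d → ℤ) : ℝ :=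
  ∑' n, pathTerm V n t z

section PathTerm

variable {d : ℕ} {V : (Fin d → ℤ) → ℝ}

lemma continuous_neighborSum {f : ℝ → (Fin d → ℤ) → ℝ} (h : ∀ z, Continuous fun t => f t z)
    (z : Fin d → ℤ) : Continuous fun t => neighborSum d (f t) z := by
  simp only [neighborSum_apply]
  exact continuous_finsetSum _ fun i _ => (h _).add (h _)

lemma continuous_pathTerm (n : ℕ) (z : Fin d → ℤ) : Continuous fun t => pathTerm V n t z := by
  induction n generalizing z with
  | zero => simp only [pathTerm]; fun_prop
  | succ n ih =>
    simp only [pathTerm]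
    refine (by fun_prop : Continuous fun t => Real.exp ((V z - 2 * d) * t)).mul ?_
    refine intervalIntegral.continuous_primitive (fun a b => ?_) 0
    exact ((by fun_prop : Continuous fun s => Real.exp (-(V z - 2 * d) * s)).mul
      (continuous_neighborSum ih z)).intervalIntegrable a b

lemma hasDerivAt_pathTerm_zero (t : ℝ) (z : Fin d → ℤ) :
    HasDerivAt (fun s => pathTerm V 0 s z) ((V z - 2 * d) * pathTerm V 0 t z) t := by
  simp only [pathTerm]
  exact ((hasDerivAt_exp_mul (V z - 2 * d) t).mul_const _).congr_deriv (by ring)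

lemma hasDerivAt_pathTerm_succ (n : ℕ) (t : ℝ) (z : Fin d → ℤ) :
    HasDerivAt (fun s => pathTerm V (n + 1) s z)
      (neighborSum d (pathTerm V n t) z + (V z - 2 * d) * pathTerm V (n + 1) t z) t := by
  have hc : Continuous fun s =>
      Real.exp (-(V z - 2 * d) * s) * neighborSum d (pathTerm V n s) z :=
    (by fun_prop : Continuous fun s => Real.exp (-(V z - 2 * d) * s)).mul
      (continuous_neighborSum (fun z => continuous_pathTerm n z) z)
  have h1 := intervalIntegral.integral_hasDerivAt_right (hc.intervalIntegrable 0 t)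
    hc.aestronglyMeasurable.stronglyMeasurableAtFilter hc.continuousAt
  simp only [pathTerm]
  refine ((hasDerivAt_exp_mul (V z - 2 * d) t).mul h1).congr_deriv ?_
  have h2 : Real.exp ((V z - 2 * d) * t) * Real.exp (-(V z - 2 * d) * t) = 1 := by
    rw [← Real.exp_add, neg_mul, add_neg_cancel, Real.exp_zero]
  linear_combination (neighborSum d (pathTerm V n t) z) * h2

lemma pathTerm_at_zero (n : ℕ) (z : Fin d → ℤ) :
    pathTerm V n 0 z = if n = 0 then (Pi.single 0 1 : (Fin d → ℤ) → ℝ) z else 0 := by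
  rcases n with _ | n <;> simp [pathTerm]

lemma single_zero_one_nonneg (z : Fin d → ℤ) : 0 ≤ (Pi.single 0 1 : (Fin d → ℤ) → ℝ) z := by
  rw [Pi.single_apply]; split_ifs <;> norm_num

lemma pathTerm_nonneg (n : ℕ) {t : ℝ} (ht : 0 ≤ t) (z : Fin d → ℤ) : 0 ≤ pathTerm V n t z := by
  induction n generalizing t z with
  | zero => exact mul_nonneg (Real.exp_pos _).le (single_zero_one_nonneg z)
  | succ n ih =>
    exact mul_nonneg (Real.exp_pos _).le (intervalIntegral.integral_nonneg ht fun s hs =>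
      mul_nonneg (Real.exp_pos _).le (neighborSum_nonneg (fun y => ih hs.1 y) z))

lemma pathTerm_eq_zero {n : ℕ} {t : ℝ} {z : Fin d → ℤ} (hz : n < latticeNorm z) :
    pathTerm V n t z = 0 := by
  induction n generalizing t z with
  | zero =>
    have : z ≠ 0 := fun h => by simp [h, latticeNorm] at hz
    simp [pathTerm, this]
  | succ n ih =>
    have hN : ∀ s, neighborSum d (pathTerm V n s) z = 0 := by
      intro s
      rw [neighborSum_apply]
      refine Finset.sum_eq_zero fun i _ => ?_
      have h1 := latticeNorm_add_le (z + Pi.single i 1) (-(Pi.single i 1 : Fin d → ℤ))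
      have h2 := latticeNorm_add_le (z - Pi.single i 1) (Pi.single i 1 : Fin d → ℤ)
      rw [add_neg_cancel_right] at h1
      rw [sub_add_cancel] at h2
      simp only [latticeNorm_neg, latticeNorm_single, Int.natAbs_one] at h1 h2
      rw [ih (by omega), ih (by omega), add_zero]
    simp [pathTerm, hN]

/-- A path with `n` jumps from the origin never leaves the ball of radius `n`, so the potential
matters only there. Replacing it by a constant leaves the count of `n`-step walks times `e^{ct} t^n
/ n!`. -/
lemma pathTerm_le {c : ℝ} {N : ℕ} (hV : ∀ z, latticeNorm z ≤ N → V z - 2 * d ≤ c) {n : ℕ}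
    (hn : n ≤ N) {t : ℝ} (ht : 0 ≤ t) (z : Fin d → ℤ) :
    pathTerm V n t z
      ≤ expMonomial c n t * (neighborSum d ^ n) (Pi.single 0 1 : (Fin d → ℤ) → ℝ) z := by
  have hnn := fun m {t : ℝ} (ht : 0 ≤ t) z => mul_nonneg (expMonomial_nonneg c m ht)
    (neighborSum_pow_nonneg (single_zero_one_nonneg (d := d)) m z)
  induction n generalizing t z with
  | zero =>
    rcases lt_or_ge 0 (latticeNorm z) with hz | hz
    · rw [pathTerm_eq_zero hz]; exact hnn 0 ht z
    · simp only [pathTerm, expMonomial, pow_zero, Nat.factorial_zero, Nat.cast_one, div_one,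
        mul_one, Module.End.one_apply]
      exact mul_le_mul_of_nonneg_right (Real.exp_le_exp.2 (mul_le_mul_of_nonneg_right
        (hV z (hz.trans (Nat.zero_le _))) ht)) (single_zero_one_nonneg z)
  | succ n ih =>
    rcases lt_or_ge (n + 1) (latticeNorm z) with hz | hz
    · rw [pathTerm_eq_zero hz]; exact hnn _ ht z
    rw [← sub_nonpos]
    refine nonpos_of_deriv_le_mul (c := c) (a := 0) (b := t)
      (f := fun r => pathTerm V (n + 1) r z - expMonomial c (n + 1) r *
        (neighborSum d ^ (n + 1)) (Pi.single 0 1 : (Fin d → ℤ) → ℝ) z) ht ?_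
      (fun r hr => (hasDerivAt_pathTerm_succ n r z).sub
        ((hasDerivAt_expMonomial_succ _ _ _).mul_const _)) ?_ ?_
    · exact ((continuous_pathTerm _ _).sub
        ((continuous_expMonomial _ _).mul continuous_const)).continuousOn
    · intro r hr
      have h1 := neighborSum_mono (fun y => ih (by omega) hr.1.le y) z
      have h2 : neighborSum d (fun y => expMonomial c n r *
          (neighborSum d ^ n) (Pi.single 0 1 : (Fin d → ℤ) → ℝ) y) z = expMonomial c n r *
          (neighborSum d ^ (n + 1)) (Pi.single 0 1 : (Fin d → ℤ) → ℝ) z := by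
        rw [neighborSum_pow_succ_apply, ← smul_eq_mul, ← Pi.smul_apply, ← map_smul]; rfl
      rw [h2] at h1
      have h3 := mul_le_mul_of_nonneg_right (hV z (hz.trans hn))
        (pathTerm_nonneg (V := V) (n + 1) hr.1.le z)
      linarith
    · simp [pathTerm_at_zero]

lemma le_pathTerm {c : ℝ} (hV : ∀ z, c ≤ V z - 2 * d) (n : ℕ) {t : ℝ} (ht : 0 ≤ t)
    (z : Fin d → ℤ) :
    expMonomial c n t * (neighborSum d ^ n) (Pi.single 0 1 : (Fin d → ℤ) → ℝ) z
      ≤ pathTerm V n t z := by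
  induction n generalizing t z with
  | zero =>
    simp only [pathTerm, expMonomial, pow_zero, Nat.factorial_zero, Nat.cast_one, div_one,
      mul_one, Module.End.one_apply]
    exact mul_le_mul_of_nonneg_right (Real.exp_le_exp.2 (mul_le_mul_of_nonneg_right (hV z) ht))
      (single_zero_one_nonneg z)
  | succ n ih =>
    rw [← sub_nonpos]
    refine nonpos_of_deriv_le_mul (c := c) (a := 0) (b := t)
      (f := fun r => expMonomial c (n + 1) r *
        (neighborSum d ^ (n + 1)) (Pi.single 0 1 : (Fin d → ℤ) → ℝ) z - pathTerm V (n + 1) r z)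
      ht ?_ (fun r hr => ((hasDerivAt_expMonomial_succ _ _ _).mul_const _).sub
        (hasDerivAt_pathTerm_succ n r z)) ?_ ?_
    · exact (((continuous_expMonomial _ _).mul continuous_const).sub
        (continuous_pathTerm _ _)).continuousOn
    · intro r hr
      have h1 := neighborSum_mono (fun y => ih hr.1.le y) z
      have h2 : neighborSum d (fun y => expMonomial c n r *
          (neighborSum d ^ n) (Pi.single 0 1 : (Fin d → ℤ) → ℝ) y) z = expMonomial c n r *
          (neighborSum d ^ (n + 1)) (Pi.single 0 1 : (Fin d → ℤ) → ℝ) z := by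
        rw [neighborSum_pow_succ_apply, ← smul_eq_mul, ← Pi.smul_apply, ← map_smul]; rfl
      rw [h2] at h1
      have h3 := mul_le_mul_of_nonneg_right (hV z)
        (pathTerm_nonneg (V := V) (n + 1) hr.1.le z)
      linarith
    · simp [pathTerm_at_zero]

lemma hasSum_neighborSum_pow_single (n : ℕ) :
    HasSum ((neighborSum d ^ n) (Pi.single 0 1 : (Fin d → ℤ) → ℝ)) ((2 * d) ^ n) := by
  induction n with
  | zero =>
    rw [pow_zero, pow_zero, Module.End.one_apply]
    exact (hasSum_ite_eq (0 : Fin d → ℤ) (1 : ℝ)).congr_fun fun z => Pi.single_apply _ _ _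
  | succ n ih =>
    rw [neighborSum_pow_succ_apply, pow_succ']
    exact hasSum_neighborSum ih

lemma neighborSum_pow_single_le (n : ℕ) (z : Fin d → ℤ) :
    (neighborSum d ^ n) (Pi.single 0 1 : (Fin d → ℤ) → ℝ) z ≤ (2 * d) ^ n :=
  le_hasSum (hasSum_neighborSum_pow_single n) z fun y _ =>
    neighborSum_pow_nonneg single_zero_one_nonneg n y

/-- A growth rate that increases linearly with the number of jumps costs only a geometric factor, so
the `1 / n!` still makes the expansion converge. -/
lemma expMonomial_add_mul (A B t : ℝ) (n : ℕ) :
    expMonomial (A + B * n) n t = expMonomial A n t * Real.exp (B * t) ^ n := by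
  rw [expMonomial, expMonomial, ← Real.exp_nat_mul, mul_right_comm, ← Real.exp_add]
  ring_nf

lemma expMonomial_mono {c s t : ℝ} (hc : 0 ≤ c) (hs : 0 ≤ s) (hst : s ≤ t) (n : ℕ) :
    expMonomial c n s ≤ expMonomial c n t := by
  unfold expMonomial; gcongr

end PathTerm

/-! ### Existence, uniqueness and mass bounds for potentials of linear growth. -/

/-- The potential is nonnegative and grows at most linearly. -/
structure HasLinearGrowth {d : ℕ} (V : (Fin d → ℤ) → ℝ) (A B : ℝ) : Prop where
  nonneg_left : 0 ≤ A
  nonneg_right : 0 ≤ B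
  nonneg : ∀ z, 0 ≤ V z
  le : ∀ z, V z ≤ A + B * latticeNorm z

section LinearGrowth

variable {d : ℕ} {V : (Fin d → ℤ) → ℝ} {A B : ℝ}

lemma HasLinearGrowth.pathTerm_le (G : HasLinearGrowth V A B) (n : ℕ) {t : ℝ} (ht : 0 ≤ t)
    (z : Fin d → ℤ) :
    pathTerm V n t z ≤ expMonomial (A + B * n) n t *
      (neighborSum d ^ n) (Pi.single 0 1 : (Fin d → ℤ) → ℝ) z := by
  refine _root_.pathTerm_le (N := n) (fun z hz => ?_) le_rfl ht z
  have h6 : B * (latticeNorm z : ℝ) ≤ B * n :=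
    mul_le_mul_of_nonneg_left (by exact_mod_cast hz) G.nonneg_right
  have h7 : (0 : ℝ) ≤ 2 * d := by positivity
  linarith [G.le z]

/-- A summable majorant that is uniform in time on `[0, T]` and in the site, as needed for termwise
continuity and differentiation. -/
lemma HasLinearGrowth.pathTerm_le_of_le (G : HasLinearGrowth V A B) (n : ℕ) {t T : ℝ}
    (ht : 0 ≤ t) (htT : t ≤ T) (z : Fin d → ℤ) :
    pathTerm V n t z ≤ expMonomial A n T * (2 * d * Real.exp (B * T)) ^ n := by
  refine (G.pathTerm_le n ht z).trans ?_
  have h1 := expMonomial_mono (c := A + B * n) (by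
    have := G.nonneg_left; have := G.nonneg_right; positivity) ht htT n
  refine (mul_le_mul h1 (neighborSum_pow_single_le n z)
    (neighborSum_pow_nonneg single_zero_one_nonneg n z)
    (expMonomial_nonneg _ _ (ht.trans htT))).trans (le_of_eq ?_)
  rw [expMonomial_add_mul, mul_pow]
  ring

lemma HasLinearGrowth.summable_pathTerm (G : HasLinearGrowth V A B) {t : ℝ} (ht : 0 ≤ t)
    (z : Fin d → ℤ) : Summable fun n => pathTerm V n t z :=
  Summable.of_nonneg_of_le (fun n => pathTerm_nonneg n ht z)
    (fun n => G.pathTerm_le_of_le n ht le_rfl z) (hasSum_expMonomial_mul_pow A _ t).summable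

lemma HasLinearGrowth.pathSolution_isNonnegPAMSolution (G : HasLinearGrowth V A B) :
    IsNonnegPAMSolution V (pathSolution V) where
  nonneg t ht z := tsum_nonneg fun n => pathTerm_nonneg n ht z
  initial z := by
    simp only [pathSolution, pathTerm_at_zero]
    rw [tsum_ite_eq, Pi.single_apply]
  continuous_zero z := by
    have h1 : ContinuousOn (fun t => pathSolution V t z) (Set.Icc 0 1) :=
      continuousOn_tsum (fun n => (continuous_pathTerm n z).continuousOn)
        (hasSum_expMonomial_mul_pow A _ 1).summable fun n t ht => by
          rw [Real.norm_of_nonneg (pathTerm_nonneg n ht.1 z)]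
          exact G.pathTerm_le_of_le n ht.1 ht.2 z
    exact (h1 0 ⟨le_rfl, zero_le_one⟩).mono_of_mem_nhdsWithin (Icc_mem_nhdsGE zero_lt_one)
  equation t ht z := by
    set T := t + 1
    set β : ℕ → ℝ := fun n => expMonomial A n T * (2 * d * Real.exp (B * T)) ^ n
    have hβ : Summable β := (hasSum_expMonomial_mul_pow A _ T).summable
    -- The inflow into the term with `n + 1` jumps comes from the term with `n` jumps, hence the
    -- index shift and the value `0` at `n = 0`.
    set γ : ℕ → ℝ → ℝ := fun n s =>
      Nat.casesOn n 0 fun m => neighborSum d (pathTerm V m s) z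
    set u : ℕ → ℝ := fun n => (Nat.casesOn n 0 fun m => 2 * d * β m) + |V z - 2 * d| * β n
    have hγu : Summable u := by
      refine Summable.add ?_ (hβ.mul_left _)
      rw [← summable_nat_add_iff 1]
      exact hβ.mul_left _
    have hN : HasSum (fun n => γ n t) (neighborSum d (pathSolution V t) z) := by
      rw [← hasSum_nat_add_iff' 1]
      simp only [Finset.range_one, Finset.sum_singleton, γ]
      change HasSum (fun n => neighborSum d (pathTerm V n t) z)
        (neighborSum d (pathSolution V t) z - 0)
      rw [sub_zero]
      simp only [neighborSum_apply]
      exact hasSum_sum fun i _ => (G.summable_pathTerm ht.le _).hasSum.add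
        (G.summable_pathTerm ht.le _).hasSum
    have hder := hasDerivAt_tsum_of_isPreconnected hγu (isOpen_Ioo (a := (0 : ℝ)) (b := T))
      isPreconnected_Ioo (g := fun n s => pathTerm V n s z)
      (g' := fun n s => γ n s + (V z - 2 * d) * pathTerm V n s z) ?_ ?_
      (y₀ := t) ⟨ht, by simp [T]⟩ (G.summable_pathTerm ht.le z) (y := t) ⟨ht, by simp [T]⟩
    · refine hder.congr_deriv ?_
      rw [(hN.add ((G.summable_pathTerm ht.le z).hasSum.mul_left _)).tsum_eq, latticeLaplacian_eq]
      change _ = neighborSum d (pathSolution V t) z - 2 * d * (∑' n, pathTerm V n t z) +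
        V z * (∑' n, pathTerm V n t z)
      ring
    · intro n s _
      rcases n with _ | n
      · simpa [γ] using hasDerivAt_pathTerm_zero s z
      · exact hasDerivAt_pathTerm_succ n s z
    · intro n s hs
      refine (norm_add_le _ _).trans (add_le_add ?_ ?_)
      · rcases n with _ | n
        · simp [γ]
        · rw [Real.norm_of_nonneg (neighborSum_nonneg (fun y => pathTerm_nonneg n hs.1.le y) z)]
          refine (neighborSum_mono (fun y => G.pathTerm_le_of_le n hs.1.le hs.2.le y) z).trans ?_
          simp only [neighborSum_apply, Finset.sum_const, Finset.card_univ, Fintype.card_fin,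
            nsmul_eq_mul, β]
          apply le_of_eq
          ring
      · rw [norm_mul, Real.norm_eq_abs, Real.norm_of_nonneg (pathTerm_nonneg n hs.1.le z)]
        exact mul_le_mul_of_nonneg_left (G.pathTerm_le_of_le n hs.1.le hs.2.le z) (abs_nonneg _)

/-- The partial sums of the path expansion lie below every nonnegative solution. -/
lemma IsNonnegPAMSolution.sum_pathTerm_le {w : ℝ → (Fin d → ℤ) → ℝ}
    (hw : IsNonnegPAMSolution V w) (N : ℕ) {t : ℝ} (ht : 0 ≤ t) (z : Fin d → ℤ) :
    ∑ n ∈ Finset.range N, pathTerm V n t z ≤ w t z := by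
  have H := hw.isNonnegEvolution
  induction N generalizing t z with
  | zero => simpa using hw.nonneg t ht z
  | succ N ih =>
    rw [← sub_nonpos]
    simp only [Finset.sum_range_succ']
    refine nonpos_of_deriv_le_mul (c := V z - 2 * d) (a := 0) (b := t)
      (f := fun r => ∑ n ∈ Finset.range N, pathTerm V (n + 1) r z + pathTerm V 0 r z - w r z)
      ht ?_ (fun r hr => ((HasDerivAt.fun_sum fun n _ => hasDerivAt_pathTerm_succ n r z).add
        (hasDerivAt_pathTerm_zero r z)).sub (H.equation r hr.1 z)) ?_ ?_
    · exact ((continuous_finsetSum _ fun n _ => continuous_pathTerm _ _).add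
        (continuous_pathTerm _ _)).continuousOn.sub ((H.continuousOn z).mono fun r hr => hr.1)
    · intro r hr
      have h1 := neighborSum_mono (fun y => ih hr.1.le y) z
      have h2 : neighborSum d (fun y => ∑ n ∈ Finset.range N, pathTerm V n r y) z
          = ∑ n ∈ Finset.range N, neighborSum d (pathTerm V n r) z := by
        have e : (fun y => ∑ n ∈ Finset.range N, pathTerm V n r y)
            = ∑ n ∈ Finset.range N, pathTerm V n r := by
          funext y; simp
        rw [e, map_sum, Finset.sum_apply]
      rw [h2] at h1
      rw [Finset.sum_add_distrib, ← Finset.mul_sum]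
      linarith
    · simp [pathTerm_at_zero, hw.initial, Pi.single_apply]

/-- Every solution dominates the partial sums, so its difference from the path solution is a
nonnegative evolution with zero initial value. -/
lemma HasLinearGrowth.eq_pathSolution (G : HasLinearGrowth V A B) {w : ℝ → (Fin d → ℤ) → ℝ}
    (hw : IsNonnegPAMSolution V w) {t : ℝ} (ht : 0 ≤ t) : w t = pathSolution V t := by
  have hv := G.pathSolution_isNonnegPAMSolution
  have H : IsNonnegEvolution V fun t z => w t z - pathSolution V t z :=
    { nonneg := fun t ht z => sub_nonneg.2
        ((G.summable_pathTerm ht z).tsum_le_of_sum_range_le fun N => hw.sum_pathTerm_le N ht z)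
      continuous_zero := fun z => (hw.continuous_zero z).sub (hv.continuous_zero z)
      equation := fun t ht z => ((hw.isNonnegEvolution.equation t ht z).sub
        (hv.isNonnegEvolution.equation t ht z)).congr_deriv (by
          have : (fun z => w t z - pathSolution V t z) = w t - pathSolution V t := rfl
          rw [this, map_sub, Pi.sub_apply]
          ring) }
  funext z
  have := H.eq_zero (fun z => by simp [hw.initial, hv.initial]) G.nonneg_left G.nonneg_right
    G.nonneg G.le ht z
  exact sub_eq_zero.1 this

lemma HasLinearGrowth.summable_pathTerm_prod (G : HasLinearGrowth V A B) {t : ℝ} (ht : 0 ≤ t) :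
    Summable fun p : ℕ × (Fin d → ℤ) => pathTerm V p.1 t p.2 := by
  have hz : ∀ n, Summable fun z => pathTerm V n t z := fun n =>
    Summable.of_nonneg_of_le (fun z => pathTerm_nonneg n ht z) (fun z => G.pathTerm_le n ht z)
      ((hasSum_neighborSum_pow_single n).summable.mul_left _)
  rw [summable_prod_of_nonneg fun p => pathTerm_nonneg p.1 ht p.2]
  refine ⟨hz, Summable.of_nonneg_of_le (fun n => tsum_nonneg fun z => pathTerm_nonneg n ht z)
    (fun n => ?_) (hasSum_expMonomial_mul_pow A (2 * d * Real.exp (B * t)) t).summable⟩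
  refine ((hz n).tsum_le_tsum (G.pathTerm_le n ht)
    ((hasSum_neighborSum_pow_single n).summable.mul_left _)).trans (le_of_eq ?_)
  rw [tsum_mul_left, (hasSum_neighborSum_pow_single n).tsum_eq, expMonomial_add_mul, mul_pow]
  ring

lemma HasLinearGrowth.hasSum_pathTerm_prod (G : HasLinearGrowth V A B) {t : ℝ} (ht : 0 ≤ t) :
    HasSum (fun p : ℕ × (Fin d → ℤ) => pathTerm V p.1 t p.2) (totalMass (pathSolution V) t) := by
  have h := G.summable_pathTerm_prod ht
  have h1 : HasSum (fun z => pathSolution V t z) (∑' p : (Fin d → ℤ) × ℕ, pathTerm V p.2 t p.1) :=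
    h.prod_symm.hasSum.prod_fiberwise fun z => (G.summable_pathTerm ht z).hasSum
  have h2 : ∑' p : (Fin d → ℤ) × ℕ, pathTerm V p.2 t p.1
      = ∑' p : ℕ × (Fin d → ℤ), pathTerm V p.1 t p.2 :=
    (Equiv.prodComm _ _).tsum_eq fun p : ℕ × (Fin d → ℤ) => pathTerm V p.1 t p.2
  rw [totalMass, h1.tsum_eq, h2]
  exact h.hasSum

lemma HasLinearGrowth.summable_pathSolution (G : HasLinearGrowth V A B) {t : ℝ} (ht : 0 ≤ t) :
    Summable (pathSolution V t) :=
  (G.summable_pathTerm_prod ht).prod_symm.prod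

/-- There are `(2 d)^n` walks with `n` jumps, each seeing a potential of at most `A + B n`; the
resulting series is again an exponential series. -/
lemma HasLinearGrowth.totalMass_le (G : HasLinearGrowth V A B) {t : ℝ} (ht : 0 ≤ t) :
    totalMass (pathSolution V) t ≤ Real.exp (A * t + 2 * d * Real.exp (B * t) * t) := by
  have h := G.hasSum_pathTerm_prod ht
  have h1 := h.prod_fiberwise fun n => (h.summable.prod_factor n).hasSum
  refine hasSum_le (fun n => ?_) h1 (hasSum_expMonomial_mul_pow A (2 * d * Real.exp (B * t)) t)
  refine hasSum_le (G.pathTerm_le n ht) (h.summable.prod_factor n).hasSum ?_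
  have e : expMonomial A n t * (2 * d * Real.exp (B * t)) ^ n
      = expMonomial (A + B * n) n t * (2 * d) ^ n := by
    rw [expMonomial_add_mul, mul_pow]
    ring
  rw [e]
  exact (hasSum_neighborSum_pow_single (d := d) n).mul_left _

/-- The Laplacian conserves mass, so a constant potential `c` has total mass exactly `e^{ct}`. -/
lemma HasLinearGrowth.le_totalMass (G : HasLinearGrowth V A B) {c : ℝ} (hc : ∀ z, c ≤ V z) {t : ℝ}
    (ht : 0 ≤ t) : Real.exp (c * t) ≤ totalMass (pathSolution V) t := by
  have h := G.hasSum_pathTerm_prod ht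
  have h1 := h.prod_fiberwise fun n => (h.summable.prod_factor n).hasSum
  rw [show c * t = (c - 2 * d) * t + 2 * d * t by ring]
  refine hasSum_le (fun n => ?_) (hasSum_expMonomial_mul_pow (c - 2 * d) (2 * d) t) h1
  refine hasSum_le (le_pathTerm (fun z => sub_le_sub_right (hc z) _) n ht) ?_
    (h.summable.prod_factor n).hasSum
  exact (hasSum_neighborSum_pow_single (d := d) n).mul_left _

/-- Upper bound for the growth rate of the total mass. -/
lemma HasLinearGrowth.logMassRate_le (G : HasLinearGrowth V A B) {t : ℝ} (ht : 0 < t) :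
    logMassRate (pathSolution V) t ≤ A + 2 * d * Real.exp (B * t) := by
  have h0 : 0 < totalMass (pathSolution V) t :=
    (Real.exp_pos _).trans_le (G.le_totalMass G.nonneg ht.le)
  have h1 := (Real.log_le_iff_le_exp h0).2 (G.totalMass_le ht.le)
  rw [logMassRate, one_div_mul_eq_div, div_le_iff₀ ht]
  linarith

lemma HasLinearGrowth.le_logMassRate (G : HasLinearGrowth V A B) {c : ℝ} (hc : ∀ z, c ≤ V z)
    {t : ℝ} (ht : 0 < t) : c ≤ logMassRate (pathSolution V) t := by
  have h1 := (Real.le_log_iff_exp_le ((Real.exp_pos _).trans_le (G.le_totalMass hc ht.le))).2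
    (G.le_totalMass hc ht.le)
  rw [logMassRate, one_div_mul_eq_div, le_div_iff₀ ht]
  exact h1

/-- Lower bound for the growth rate of the total mass: the process moves to a site `z` during the
first half of the time and stays there for the second half. -/
lemma HasLinearGrowth.site_le_logMassRate (G : HasLinearGrowth V A B) {t : ℝ} (ht : 0 < t)
    (z : Fin d → ℤ) :
    V z / 2 - 2 * d - latticeNorm z / t * Real.log (2 * latticeNorm z / t)
      ≤ logMassRate (pathSolution V) t := by
  have hv := G.pathSolution_isNonnegPAMSolution
  have H := hv.isNonnegEvolution
  set n := latticeNorm z with hn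
  have h1 := H.expMonomial_mul_apply_le G.nonneg le_rfl (half_pos ht).le z 0
  have h2 := H.exp_mul_le (half_pos ht).le (half_le_self ht.le) z
  rw [hv.initial, if_pos rfl, sub_zero, mul_one, sub_zero, ← hn] at h1
  have h3 : pathSolution V t z ≤ totalMass (pathSolution V) t :=
    (G.summable_pathSolution ht.le).le_tsum z fun y _ => hv.nonneg t ht.le y
  -- The probability-like weight of `n` jumps in time `t / 2` is estimated through `n! ≤ n^n`; the
  -- case `n = 0` is separate because of the logarithm.
  have h4 : Real.exp (-(n * Real.log (2 * n / t))) ≤ (t / 2) ^ n / n.factorial := by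
    rcases Nat.eq_zero_or_pos n with h0 | hpos
    · simp [h0]
    · have hn0 : (0 : ℝ) < n := by exact_mod_cast hpos
      have e1 : Real.exp (-(n * Real.log (2 * n / t))) = (t / 2) ^ n / (n : ℝ) ^ n := by
        rw [← mul_neg, ← Real.log_inv, Real.exp_nat_mul, Real.exp_log (by positivity), ← div_pow]
        congr 1
        field_simp
      rw [e1]
      have : (n.factorial : ℝ) ≤ (n : ℝ) ^ n := by exact_mod_cast Nat.factorial_le_pow n
      gcongr
  have h5 : Real.exp ((V z / 2 - 2 * d) * t - n * Real.log (2 * n / t))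
      ≤ totalMass (pathSolution V) t := by
    have e : (V z / 2 - 2 * d) * t - n * Real.log (2 * n / t)
        = (V z - 2 * d) * (t - t / 2) + (-(2 * d) * (t / 2) + -(n * Real.log (2 * n / t))) := by
      ring
    rw [e, Real.exp_add, Real.exp_add]
    refine le_trans ?_ (h2.trans h3)
    refine mul_le_mul_of_nonneg_left (le_trans ?_ h1) (Real.exp_pos _).le
    exact mul_le_mul_of_nonneg_left h4 (Real.exp_pos _).le
  have h6 := (Real.le_log_iff_exp_le ((Real.exp_pos _).trans_le h5)).2 h5
  rw [logMassRate, one_div_mul_eq_div, le_div_iff₀ ht]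
  have : (V z / 2 - 2 * d - n / t * Real.log (2 * n / t)) * t
      = (V z / 2 - 2 * d) * t - n * Real.log (2 * n / t) := by field_simp
  linarith

end LinearGrowth

/-! ### Exceedance probabilities for the Pareto field. -/

/-- An i.i.d. field of Pareto variables with tail exponent `α` on `ℤ^d`. -/
structure IsParetoField {Ω : Type*} [MeasurableSpace Ω] {d : ℕ} (ξ : (Fin d → ℤ) → Ω → ℝ)
    (μ : Measure Ω) (α : ℝ) : Prop where
  measurable : ∀ z, Measurable (ξ z)
  indep : iIndepFun ξ μ
  cdf : ∀ z, ∀ x : ℝ, 1 ≤ x → μ.real {ω | ξ z ω ≤ x} = 1 - x ^ (-α)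

section Pareto

variable {Ω : Type*} [MeasurableSpace Ω] {μ : Measure Ω} [IsProbabilityMeasure μ] {d : ℕ} {α : ℝ}
  {ξ : (Fin d → ℤ) → Ω → ℝ}

lemma IsParetoField.ae_one_lt (P : IsParetoField ξ μ α) : ∀ᵐ ω ∂μ, ∀ z, 1 < ξ z ω := by
  rw [ae_all_iff]
  intro z
  rw [ae_iff]
  have h := P.cdf z 1 le_rfl
  rw [Real.one_rpow, sub_self, measureReal_eq_zero_iff] at h
  simpa using h

lemma IsParetoField.tail_le (P : IsParetoField ξ μ α) (hα : 0 < α) (z : Fin d → ℤ) {x : ℝ}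
    (hx : 0 < x) : μ {ω | x < ξ z ω} ≤ ENNReal.ofReal (x ^ (-α)) := by
  rw [ENNReal.le_ofReal_iff_toReal_le (measure_ne_top _ _) (by positivity)]
  change μ.real _ ≤ _
  rcases le_or_gt 1 x with h1 | h1
  · have h := P.cdf z x h1
    have hc := measureReal_compl (μ := μ) (measurableSet_le (P.measurable z) (measurable_const (a := x)))
    have e : {ω | ξ z ω ≤ x}ᶜ = {ω | x < ξ z ω} := by ext; simp
    rw [e, h, probReal_univ] at hc
    linarith
  · exact measureReal_le_one.trans
      (Real.one_le_rpow_of_pos_of_le_one_of_nonpos hx h1.le (by linarith))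

/-- The probability that finitely many sites all have potential below prescribed levels. -/
lemma IsParetoField.measure_forall_le (P : IsParetoField ξ μ α) {ι : Type*}
    (F : Finset ι) (g : ι → Fin d → ℤ) (hg : Set.InjOn g F) (y : ι → ℝ) (hy : ∀ i ∈ F, 1 ≤ y i) :
    μ {ω | ∀ i ∈ F, ξ (g i) ω ≤ y i} ≤ ENNReal.ofReal (Real.exp (-∑ i ∈ F, (y i) ^ (-α))) := by
  have hg' : Function.Injective fun i : F => g i := fun i j hij => Subtype.ext (hg i.2 j.2 hij)
  have hind := P.indep.precomp hg'
  have h1 := hind.measure_inter_preimage_eq_mul Finset.univ (sets := fun i : F => Set.Iic (y i))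
    fun i _ => measurableSet_Iic
  have e : {ω | ∀ i ∈ F, ξ (g i) ω ≤ y i}
      = ⋂ i ∈ (Finset.univ : Finset F), (ξ (g i)) ⁻¹' Set.Iic (y i) := by
    ext ω; simp
  rw [e, h1, ENNReal.le_ofReal_iff_toReal_le (by
    rw [← h1]; exact measure_ne_top _ _) (Real.exp_pos _).le, ENNReal.toReal_prod,
    ← Finset.sum_neg_distrib, Real.exp_sum, ← Finset.prod_coe_sort F]
  refine Finset.prod_le_prod (fun i _ => ENNReal.toReal_nonneg) fun i _ => ?_
  have h2 := P.cdf (g i) (y i) (hy i i.2)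
  have h3 : (μ (ξ (g i) ⁻¹' Set.Iic (y i))).toReal = 1 - (y i) ^ (-α) := h2
  rw [h3]
  -- Each factor satisfies `1 - p ≤ e^{-p}`.
  linarith [Real.add_one_le_exp (-(y i) ^ (-α))]

/-- The sup-norm ball of radius `N` in `ℤ^d`. -/
noncomputable def latticeBox (d N : ℕ) : Finset (Fin d → ℤ) := Finset.Icc (fun _ => -(N : ℤ)) (fun _ => (N : ℤ))

lemma card_latticeBox (d N : ℕ) : (latticeBox d N).card = (2 * N + 1) ^ d := by
  rw [latticeBox, Pi.card_Icc]
  simp only [Int.card_Icc, Finset.prod_const, Finset.card_univ, Fintype.card_fin]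
  congr 1
  omega

lemma mem_latticeBox {N : ℕ} {z : Fin d → ℤ} (h : latticeNorm z ≤ N) : z ∈ latticeBox d N := by
  have h1 : ∀ i, (z i).natAbs ≤ N := fun i =>
    (Finset.single_le_sum (f := fun i => (z i).natAbs) (fun _ _ => Nat.zero_le _)
      (Finset.mem_univ i)).trans h
  simp only [latticeBox, Finset.mem_Icc, Pi.le_def]
  exact ⟨fun i => by have := h1 i; omega, fun i => by have := h1 i; omega⟩

lemma IsParetoField.measure_exists_box (P : IsParetoField ξ μ α) (hα : 0 < α) (N : ℕ) {x : ℝ}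
    (hx : 0 < x) : μ {ω | ∃ z ∈ latticeBox d N, x < ξ z ω}
      ≤ ENNReal.ofReal ((2 * N + 1) ^ d * x ^ (-α)) := by
  have e : {ω | ∃ z ∈ latticeBox d N, x < ξ z ω} = ⋃ z ∈ latticeBox d N, {ω | x < ξ z ω} := by
    ext; simp
  rw [e]
  refine (measure_biUnion_finset_le _ _).trans
    ((Finset.sum_le_sum fun z _ => P.tail_le hα z hx).trans (le_of_eq ?_))
  rw [Finset.sum_const, card_latticeBox, nsmul_eq_mul, ENNReal.ofReal_mul (by positivity)]
  congr 1
  rw [ENNReal.ofReal_eq_coe_nnreal (by positivity)]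
  norm_cast

/-- The field exceeds the cone `ℓ + b |z|` with probability of order `ℓ^(-(α - d)) b^(-d)`. -/
lemma IsParetoField.exists_measure_cone_le (P : IsParetoField ξ μ α) (hα : (d : ℝ) < α) :
    ∃ C : ℝ, 0 < C ∧ ∀ ℓ b : ℝ, 0 < b → b ≤ ℓ →
      μ {ω | ∃ z, ℓ + b * latticeNorm z < ξ z ω}
        ≤ ENNReal.ofReal (C * (ℓ ^ (-(α - d)) * b ^ (-(d : ℝ)))) := by
  have hα0 : 0 < α := (Nat.cast_nonneg d).trans_lt hα
  set q : ℝ := 2 ^ (-(α - d)) with hq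
  have hq0 : 0 < q := by positivity
  have hq1 : q < 1 := Real.rpow_lt_one_of_one_lt_of_neg (by norm_num) (by linarith)
  have hq1' : 0 < 1 - q := by linarith
  refine ⟨6 ^ d * 2 ^ α * (1 - q)⁻¹, by positivity, fun ℓ b hb hbℓ => ?_⟩
  have hℓ : 0 < ℓ := hb.trans_le hbℓ
  set N : ℕ := ⌈ℓ / b⌉₊ with hN
  have hN1 : ℓ ≤ b * N := by
    have := Nat.le_ceil (ℓ / b)
    rwa [div_le_iff₀ hb, mul_comm] at this
  have h1b : 1 ≤ ℓ / b := (one_le_div hb).2 hbℓ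
  have hN2 : (N : ℝ) ≤ 2 * (ℓ / b) := by
    have := Nat.ceil_lt_add_one (a := ℓ / b) (by positivity)
    linarith
  have hN0 : (1 : ℝ) ≤ N := h1b.trans (Nat.le_ceil _)
  -- Decomposition into dyadic shells of radius `N 2^k` with `N ≈ ℓ / b`: by minimality of `k` the
  -- cone has height at least `ℓ 2^k / 2` on the `k`-th shell.
  have hsub : {ω | ∃ z, ℓ + b * latticeNorm z < ξ z ω}
      ⊆ ⋃ k : ℕ, {ω | ∃ z ∈ latticeBox d (N * 2 ^ k), ℓ * 2 ^ k / 2 < ξ z ω} := by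
    rintro ω ⟨z, hz⟩
    have hex : ∃ k : ℕ, latticeNorm z ≤ N * 2 ^ k := by
      refine ⟨latticeNorm z, (Nat.lt_two_pow_self).le.trans ?_⟩
      exact Nat.le_mul_of_pos_left _ (by exact_mod_cast (zero_lt_one.trans_le hN0))
    classical
    rw [Set.mem_iUnion]
    refine ⟨Nat.find hex, z, mem_latticeBox (Nat.find_spec hex), lt_of_le_of_lt ?_ hz⟩
    rcases hk : Nat.find hex with _ | k
    · have : 0 ≤ b * (latticeNorm z : ℝ) := by positivity
      rw [pow_zero]
      linarith
    · have h2 := Nat.find_min hex (m := k) (by omega)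
      have h3 : ((N : ℝ) * 2 ^ k) ≤ latticeNorm z := by exact_mod_cast (not_le.1 h2).le
      have h4 : ℓ * 2 ^ k ≤ b * latticeNorm z := by
        calc ℓ * 2 ^ k ≤ b * N * 2 ^ k := by gcongr
          _ = b * (N * 2 ^ k) := by ring
          _ ≤ _ := by gcongr
      rw [pow_succ]
      linarith
  -- The `k`-th shell has volume of order `2^{kd}` and tail of order `2^{-kα}`, so the union bound
  -- is geometric precisely because `α > d`.
  have hterm : ∀ k : ℕ, ((2 * ((N * 2 ^ k : ℕ) : ℝ) + 1) ^ d * (ℓ * 2 ^ k / 2) ^ (-α))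
      ≤ (6 ^ d * 2 ^ α * (ℓ ^ (-(α - d)) * b ^ (-(d : ℝ)))) * q ^ k := by
    intro k
    have hk1 : (1 : ℝ) ≤ 2 ^ k := one_le_pow₀ (by norm_num)
    have h1 : (2 * ((N * 2 ^ k : ℕ) : ℝ) + 1) ≤ 6 * (ℓ / b) * 2 ^ k := by
      push_cast
      have : (1 : ℝ) ≤ N * 2 ^ k := by nlinarith
      have : (N : ℝ) * 2 ^ k ≤ 2 * (ℓ / b) * 2 ^ k := by gcongr
      linarith
    have h2 : (ℓ * 2 ^ k / 2) ^ (-α) = ℓ ^ (-α) * ((2 : ℝ) ^ k) ^ (-α) * 2 ^ α := by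
      rw [Real.div_rpow (by positivity) (by norm_num), Real.mul_rpow hℓ.le (by positivity),
        Real.rpow_neg (by norm_num : (0 : ℝ) ≤ 2) α, div_inv_eq_mul]
    have h3 : (6 * (ℓ / b) * 2 ^ k) ^ d
        = 6 ^ d * (ℓ ^ (d : ℝ) * b ^ (-(d : ℝ))) * ((2 : ℝ) ^ k) ^ (d : ℝ) := by
      rw [mul_pow, mul_pow, div_pow, Real.rpow_neg hb.le, Real.rpow_natCast, Real.rpow_natCast,
        Real.rpow_natCast, div_eq_mul_inv]
    have h4 : q ^ k = ((2 : ℝ) ^ k) ^ (d : ℝ) * ((2 : ℝ) ^ k) ^ (-α) := by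
      rw [← Real.rpow_add (by positivity), hq, ← Real.rpow_natCast, ← Real.rpow_natCast,
        ← Real.rpow_mul (by norm_num), ← Real.rpow_mul (by norm_num)]
      ring_nf
    have h5 : ℓ ^ (-(α - d)) = ℓ ^ (d : ℝ) * ℓ ^ (-α) := by
      rw [← Real.rpow_add hℓ]; ring_nf
    rw [h2, h4, h5]
    refine (mul_le_mul_of_nonneg_right (pow_le_pow_left₀ (by positivity) h1 d)
      (by positivity)).trans (le_of_eq ?_)
    rw [h3]
    ring
  have hgeom := (hasSum_geometric_of_lt_one hq0.le hq1).mul_left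
    (6 ^ d * 2 ^ α * (ℓ ^ (-(α - d)) * b ^ (-(d : ℝ))))
  refine (measure_mono hsub).trans ((measure_iUnion_le _).trans ?_)
  refine (ENNReal.tsum_le_tsum fun k => (P.measure_exists_box hα0 _ (by positivity)).trans
    (ENNReal.ofReal_le_ofReal (hterm k))).trans ?_
  rw [← ENNReal.ofReal_tsum_of_nonneg (fun k => by positivity) hgeom.summable, hgeom.tsum_eq]
  exact ENNReal.ofReal_le_ofReal (le_of_eq (by ring))

/-- The cube `(r / 2, r]^d` in `ℤ^d`. -/
noncomputable def latticeCube (d : ℕ) (r : ℝ) : Finset (Fin d → ℤ) :=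
  Finset.Icc (fun _ => (⌊r / 2⌋₊ : ℤ) + 1) (fun _ => (⌊r⌋₊ : ℤ))

lemma card_latticeCube_ge {r : ℝ} (hr : 4 ≤ r) : (r / 4) ^ d ≤ (latticeCube d r).card := by
  rw [latticeCube, Pi.card_Icc]
  simp only [Int.card_Icc, Finset.prod_const, Finset.card_univ, Fintype.card_fin, Nat.cast_pow]
  refine pow_le_pow_left₀ (by linarith) ?_ d
  have h1 := Nat.floor_le (a := r / 2) (by linarith)
  have h2 := Nat.lt_floor_add_one r
  have h3 : ((⌊r⌋₊ : ℝ) - ⌊r / 2⌋₊) ≤ ((⌊r⌋₊ : ℤ) + 1 - ((⌊r / 2⌋₊ : ℤ) + 1)).toNat := by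
    have := Int.self_le_toNat ((⌊r⌋₊ : ℤ) + 1 - ((⌊r / 2⌋₊ : ℤ) + 1))
    have h4 : (((⌊r⌋₊ : ℤ) + 1 - ((⌊r / 2⌋₊ : ℤ) + 1) : ℤ) : ℝ)
        ≤ ((((⌊r⌋₊ : ℤ) + 1 - ((⌊r / 2⌋₊ : ℤ) + 1)).toNat : ℤ) : ℝ) := by exact_mod_cast this
    push_cast at h4 ⊢
    linarith
  linarith

lemma latticeNorm_le_of_mem_latticeCube {r : ℝ} (hr : 0 ≤ r) {z : Fin d → ℤ}
    (hz : z ∈ latticeCube d r) : (latticeNorm z : ℝ) ≤ d * r := by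
  simp only [latticeCube, Finset.mem_Icc, Pi.le_def] at hz
  have h1 : latticeNorm z ≤ ∑ _i : Fin d, ⌊r⌋₊ := Finset.sum_le_sum fun i _ => by
    have := hz.1 i; have := hz.2 i; omega
  have h2 : (latticeNorm z : ℝ) ≤ d * ⌊r⌋₊ := by
    rw [Finset.sum_const, Finset.card_univ, Fintype.card_fin, smul_eq_mul] at h1
    exact_mod_cast h1
  exact h2.trans (mul_le_mul_of_nonneg_left (Nat.floor_le hr) (Nat.cast_nonneg d))

lemma latticeCube_disjoint (hd : 1 ≤ d) {r r' : ℝ} (h : 2 * r ≤ r') {z : Fin d → ℤ}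
    (hz : z ∈ latticeCube d r) : z ∉ latticeCube d r' := by
  intro hz'
  simp only [latticeCube, Finset.mem_Icc, Pi.le_def] at hz hz'
  have h1 := hz.2 ⟨0, hd⟩
  have h2 := hz'.1 ⟨0, hd⟩
  have h3 : ⌊r⌋₊ ≤ ⌊r' / 2⌋₊ := Nat.floor_le_floor (by linarith)
  omega

end Pareto

/-! ### The time scale and the deterministic bounds expressed in it. -/

/-- The order of magnitude `(T / log T)^β` of the growth rate at time `T`. -/
noncomputable def levelScale (β T : ℝ) : ℝ := (T / Real.log T) ^ β

lemma eventually_mul_log_rpow_le (C q : ℝ) {p : ℝ} (hp : 0 < p) :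
    ∀ᶠ T : ℝ in atTop, C * Real.log T ^ q ≤ T ^ p := by
  have h := (isLittleO_log_rpow_rpow_atTop q hp).const_mul_left C
  filter_upwards [h.bound zero_lt_one, eventually_gt_atTop 0] with T hT hT0
  rw [one_mul, Real.norm_of_nonneg (Real.rpow_nonneg hT0.le p)] at hT
  exact (le_abs_self _).trans hT

lemma eventually_one_le_log : ∀ᶠ T : ℝ in atTop, 1 ≤ Real.log T :=
  Real.tendsto_log_atTop.eventually_ge_atTop 1

lemma levelScale_pos {β T : ℝ} (hT : 0 < T) (hl : 0 < Real.log T) : 0 < levelScale β T :=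
  Real.rpow_pos_of_pos (div_pos hT hl) β

lemma log_levelScale {β T : ℝ} (hT : 0 < T) (hl : 0 < Real.log T) :
    Real.log (levelScale β T) = β * (Real.log T - Real.log (Real.log T)) := by
  rw [levelScale, Real.log_rpow (div_pos hT hl), Real.log_div hT.ne' hl.ne']

lemma log_log_le_of_le_two_mul {T t : ℝ} (hT : 2 ≤ T) (hTt : T ≤ t) (ht : t ≤ 2 * T) :
    Real.log (Real.log t) ≤ Real.log (Real.log T) + Real.log 2 := by
  have hT0 : 0 < Real.log T := Real.log_pos (by linarith)
  rw [← Real.log_mul hT0.ne' two_ne_zero]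
  refine Real.log_le_log (Real.log_pos (by linarith)) ?_
  have h1 : Real.log t ≤ Real.log (2 * T) := Real.log_le_log (by linarith) ht
  rw [Real.log_mul two_ne_zero (by linarith)] at h1
  have h2 : Real.log 2 ≤ Real.log T := Real.log_le_log two_pos hT
  linarith

section Rates

variable {d : ℕ} {β : ℝ}

/-- A potential below the cone of height `(T / log T)^β Λ` and slope `β log T / (4 T)` yields a
growth rate of order at most `(T / log T)^β Λ`. -/
lemma eventually_logMassRate_le (hβ : 0 < β) : ∀ᶠ T : ℝ in atTop, ∀ Λ : ℝ, 1 ≤ Λ →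
    ∀ V : (Fin d → ℤ) → ℝ,
      HasLinearGrowth V (levelScale β T * Λ) (β / 2 * Real.log T / (2 * T)) →
      ∀ t ∈ Set.Icc T (2 * T),
        logMassRate (pathSolution V) t ≤ 2 * (levelScale β T * Λ) := by
  filter_upwards [eventually_one_le_log, eventually_gt_atTop 0,
    eventually_mul_log_rpow_le (2 * d) β (half_pos hβ)] with T hl hT h Λ hΛ V G t ht
  have hs := levelScale_pos (β := β) hT (by linarith)
  refine (G.logMassRate_le (hT.trans_le ht.1)).trans ?_
  -- The slope is chosen so that over times up to `2T` the factor `e^{Bt}` is at most `T^{β/2}`,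
  -- which is negligible against `levelScale β T`.
  have h1 : Real.exp (β / 2 * Real.log T / (2 * T) * t) ≤ T ^ (β / 2) := by
    rw [Real.rpow_def_of_pos hT]
    refine Real.exp_le_exp.2 ?_
    have : β / 2 * Real.log T / (2 * T) * t ≤ β / 2 * Real.log T / (2 * T) * (2 * T) :=
      mul_le_mul_of_nonneg_left ht.2 (by positivity)
    rw [div_mul_cancel₀ _ (by positivity)] at this
    linarith
  have h2 : 2 * d * T ^ (β / 2) ≤ levelScale β T := by
    rw [levelScale, Real.div_rpow hT.le (by linarith), le_div_iff₀ (by positivity)]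
    have e : T ^ β = T ^ (β / 2) * T ^ (β / 2) := by
      rw [← Real.rpow_add hT, add_halves]
    rw [e, mul_right_comm]
    exact mul_le_mul_of_nonneg_right h (by positivity)
  have h3 : 2 * d * Real.exp (β / 2 * Real.log T / (2 * T) * t) ≤ 2 * d * T ^ (β / 2) := by gcongr
  have h4 : levelScale β T ≤ levelScale β T * Λ := le_mul_of_one_le_right hs.le hΛ
  linarith

lemma log_sub_le_of_le_levelScale (hβ : 0 < β) {T t Λ L : ℝ} (hT : 2 ≤ T) (hTt : T ≤ t)
    (ht : t ≤ 2 * T) (hΛ : 0 < Λ) (hL : 0 < L) (h : L ≤ 2 * (levelScale β T * Λ)) :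
    Real.log L - β * Real.log t
      ≤ -(β * Real.log (Real.log t)) + Real.log Λ + (1 + β) * Real.log 2 := by
  have hl : 0 < Real.log T := Real.log_pos (by linarith)
  have hs := levelScale_pos (β := β) (by linarith) hl
  have h1 := Real.log_le_log hL h
  rw [Real.log_mul two_ne_zero (by positivity), Real.log_mul hs.ne' hΛ.ne',
    log_levelScale (by linarith) hl] at h1
  have h2 := mul_le_mul_of_nonneg_left (log_log_le_of_le_two_mul hT hTt ht) hβ.le
  have h3 := mul_le_mul_of_nonneg_left (Real.log_le_log (by linarith) hTt) hβ.le
  linarith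

lemma le_log_sub_of_levelScale_le (hβ : 0 < β) {T t Λ L : ℝ} (hT : 2 ≤ T) (hTt : T ≤ t)
    (ht : t ≤ 2 * T) (hΛ : 0 < Λ) (h : levelScale β T * Λ / 4 ≤ L) :
    -(β * Real.log (Real.log t)) + Real.log Λ - (Real.log 4 + β * Real.log 2)
      ≤ Real.log L - β * Real.log t := by
  have hl : 0 < Real.log T := Real.log_pos (by linarith)
  have hs := levelScale_pos (β := β) (by linarith) hl
  have h1 := Real.log_le_log (by positivity) h
  rw [Real.log_div (by positivity) (by norm_num), Real.log_mul hs.ne' hΛ.ne',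
    log_levelScale (by linarith) hl] at h1
  have h2 := mul_le_mul_of_nonneg_left (Real.log_le_log hl
    (Real.log_le_log (by linarith) hTt)) hβ.le
  have h3 := mul_le_mul_of_nonneg_left (Real.log_le_log (by linarith) ht) hβ.le
  rw [Real.log_mul two_ne_zero (by linarith)] at h3
  linarith

/-- A site of potential `(T / log T)^β Λ` at distance of order `(T / log T)^(β + 1) Λ` yields a
growth rate of order at least `(T / log T)^β Λ`. -/
lemma eventually_le_logMassRate (hβ : 0 < β) {c : ℝ} (hc : 0 < c)
    (hcd : 8 * (d * (β + 1) * c) ≤ 1) (q : ℝ) :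
    ∀ᶠ T : ℝ in atTop, ∀ Λ : ℝ, (Real.log T)⁻¹ ≤ Λ → Λ ≤ Real.log T ^ q →
      ∀ (V : (Fin d → ℤ) → ℝ) (A B : ℝ), HasLinearGrowth V A B →
      (∃ z ∈ latticeCube d (c * (T / Real.log T * (levelScale β T * Λ))),
        levelScale β T * Λ < V z) →
      ∀ t ∈ Set.Icc T (2 * T), levelScale β T * Λ / 4 ≤ logMassRate (pathSolution V) t := by
  filter_upwards [eventually_one_le_log, eventually_gt_atTop 1,
    eventually_mul_log_rpow_le (16 * d) (1 + β) hβ, eventually_mul_log_rpow_le 1 q one_pos]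
    with T hl hT1 hgrow hq Λ hΛ1 hΛ2 V A B G ⟨z, hz, hzV⟩ t ht
  have hT : 0 < T := by linarith
  have hl0 : 0 < Real.log T := by linarith
  have ht0 : 0 < t := hT.trans_le ht.1
  have hs := levelScale_pos (β := β) hT hl0
  have hΛ : 0 < Λ := (inv_pos.2 hl0).trans_le hΛ1
  set x := levelScale β T * Λ with hx
  have hx0 : 0 < x := by positivity
  -- This absorbs the loss `2 d` from jumping into `x / 8`; together with a travel cost of at most
  -- `x / 8`, the rate `x / 2` is left with `x / 4`.
  have hx1 : 16 * d ≤ x := by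
    have h1 : 16 * d * Real.log T ≤ levelScale β T := by
      rw [levelScale, Real.div_rpow hT.le hl0.le, le_div_iff₀ (by positivity)]
      rwa [Real.rpow_add hl0, Real.rpow_one, ← mul_assoc] at hgrow
    calc (16 * d : ℝ) = 16 * d * Real.log T * (Real.log T)⁻¹ := by field_simp
      _ ≤ levelScale β T * Λ := mul_le_mul h1 hΛ1 (by positivity) hs.le
  -- The upper restriction on `Λ` serves to bound the logarithm in the travel cost by `(β + 1) log
  -- T`.
  have hxT : x ≤ T ^ (β + 1) := by
    rw [Real.rpow_add hT, Real.rpow_one]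
    rw [one_mul, Real.rpow_one] at hq
    refine mul_le_mul ?_ (hΛ2.trans hq) hΛ.le (by positivity)
    exact Real.rpow_le_rpow (by positivity) (div_le_self hT.le hl) hβ.le
  have hn := latticeNorm_le_of_mem_latticeCube (r := c * (T / Real.log T * x)) (by positivity) hz
  set n : ℝ := (latticeNorm z : ℝ) with hndef
  have hn0 : 0 ≤ n := Nat.cast_nonneg _
  have hnt : n / t ≤ d * c * x / Real.log T := by
    have h1 : n / t ≤ n / T := div_le_div_of_nonneg_left hn0 hT ht.1
    refine h1.trans ((div_le_div_of_nonneg_right hn hT.le).trans (le_of_eq ?_))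
    field_simp
  have hlog : Real.log (2 * n / t) ≤ (β + 1) * Real.log T := by
    rcases eq_or_lt_of_le hn0 with h0 | hpos
    · rw [← h0]; simp; positivity
    · rw [← Real.log_rpow hT]
      refine Real.log_le_log (by positivity) (le_trans ?_ hxT)
      have h2 : d * c * x / Real.log T ≤ d * c * x := div_le_self (by positivity) hl
      have h3 : 2 * (d * c) ≤ 1 := by
        have : (0 : ℝ) ≤ d * c := by positivity
        nlinarith
      have h4 : 2 * (d * c) * x ≤ 1 * x := mul_le_mul_of_nonneg_right h3 hx0.le
      rw [mul_div_assoc]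
      linarith
  have hcost : n / t * Real.log (2 * n / t) ≤ x / 8 := by
    calc n / t * Real.log (2 * n / t) ≤ n / t * ((β + 1) * Real.log T) :=
          mul_le_mul_of_nonneg_left hlog (by positivity)
      _ ≤ d * c * x / Real.log T * ((β + 1) * Real.log T) :=
          mul_le_mul_of_nonneg_right hnt (by positivity)
      _ = d * (β + 1) * c * x := by field_simp
      _ ≤ x / 8 := by nlinarith
  have h5 := G.site_le_logMassRate ht0 z
  linarith

end Rates

/-! ### Critical series and reduction to dyadic times. -/

lemma one_le_one_add_log_natCast (n : ℕ) : 1 ≤ 1 + Real.log n := by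
  linarith [Real.log_natCast_nonneg n]

lemma inv_mul_one_add_log_rpow_antitone {p : ℝ} (hp : 0 ≤ p) ⦃m n : ℕ⦄ (hm : 0 < m)
    (hmn : m ≤ n) : ((n : ℝ) * (1 + Real.log n) ^ p)⁻¹ ≤ ((m : ℝ) * (1 + Real.log m) ^ p)⁻¹ := by
  have hm' : (0 : ℝ) < m := by exact_mod_cast hm
  have h1 := one_le_one_add_log_natCast m
  have h2 : Real.log m ≤ Real.log n := Real.log_le_log hm' (by exact_mod_cast hmn)
  have h3 : (m : ℝ) ≤ n := by exact_mod_cast hmn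
  refine inv_anti₀ (by positivity) ?_
  refine mul_le_mul h3 (Real.rpow_le_rpow (by linarith) (by linarith) hp) (by positivity)
    (by positivity)

lemma two_pow_mul_inv_mul_one_add_log_rpow (p : ℝ) (k : ℕ) :
    (2 : ℝ) ^ k * (((2 ^ k : ℕ) : ℝ) * (1 + Real.log ((2 ^ k : ℕ) : ℝ)) ^ p)⁻¹
      = ((1 + k * Real.log 2) ^ p)⁻¹ := by
  rw [Nat.cast_pow, Nat.cast_ofNat, Real.log_pow, mul_inv, mul_inv_cancel_left₀ (by positivity)]

/-- Cauchy condensation reduces the series to `∑ (1 + k log 2)^(-p)`. The summand `1` keeps the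
logarithmic factor at least one for all `n`. -/
lemma summable_inv_mul_one_add_log_rpow {p : ℝ} (hp : 1 < p) :
    Summable fun n : ℕ => ((n : ℝ) * (1 + Real.log n) ^ p)⁻¹ := by
  rw [← summable_condensed_iff_of_nonneg (fun n => by
      have := one_le_one_add_log_natCast n; positivity)
    (inv_mul_one_add_log_rpow_antitone (by linarith))]
  simp only [two_pow_mul_inv_mul_one_add_log_rpow]
  have hl2 : 0 < Real.log 2 := Real.log_pos one_lt_two
  have h1 : Summable fun k : ℕ => (Real.log 2 ^ p)⁻¹ * ((k : ℝ) ^ p)⁻¹ :=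
    (Real.summable_nat_rpow_inv.2 hp).mul_left _
  rw [← summable_nat_add_iff 1] at h1 ⊢
  refine Summable.of_nonneg_of_le (fun k => by positivity) (fun k => ?_) h1
  rw [← mul_inv, ← Real.mul_rpow hl2.le (by positivity)]
  refine inv_anti₀ (by positivity) (Real.rpow_le_rpow (by positivity) ?_ (by linarith))
  linarith

lemma not_summable_inv_mul_one_add_log :
    ¬ Summable fun n : ℕ => ((n : ℝ) * (1 + Real.log n))⁻¹ := by
  have e : (fun n : ℕ => ((n : ℝ) * (1 + Real.log n))⁻¹)
      = fun n : ℕ => ((n : ℝ) * (1 + Real.log n) ^ (1 : ℝ))⁻¹ := by simp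
  rw [e, ← summable_condensed_iff_of_nonneg (fun n => by
      have := one_le_one_add_log_natCast n; positivity)
    (inv_mul_one_add_log_rpow_antitone zero_le_one)]
  simp only [two_pow_mul_inv_mul_one_add_log_rpow]
  simp only [Real.rpow_one]
  intro h
  refine Real.not_summable_natCast_inv ((summable_nat_add_iff 1).1
    (Summable.of_nonneg_of_le (fun k => by positivity) (fun k => ?_) h))
  have hl2 : Real.log 2 ≤ 1 := by linarith [Real.log_two_lt_d9]
  have hl0 : 0 < Real.log 2 := Real.log_pos one_lt_two
  refine inv_anti₀ (by positivity) ?_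
  have : (k : ℝ) * Real.log 2 ≤ k * 1 := mul_le_mul_of_nonneg_left hl2 (Nat.cast_nonneg k)
  push_cast
  linarith

lemma eventually_atTop_of_dyadic {Q : ℝ → Prop}
    (h : ∀ᶠ j : ℕ in atTop, ∀ t ∈ Set.Icc ((2 : ℝ) ^ j) (2 * 2 ^ j), Q t) :
    ∀ᶠ t : ℝ in atTop, Q t := by
  obtain ⟨J, hJ⟩ := eventually_atTop.1 h
  filter_upwards [eventually_ge_atTop ((2 : ℝ) ^ J)] with t ht
  obtain ⟨j, hj1, hj2⟩ := exists_nat_pow_near ((one_le_pow₀ one_le_two).trans ht) one_lt_two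
  refine hJ j ?_ t ⟨hj1, by rw [pow_succ'] at hj2; exact hj2.le⟩
  by_contra! hlt
  have : (2 : ℝ) ^ (j + 1) ≤ 2 ^ J := pow_le_pow_right₀ one_le_two (by omega)
  linarith

/-! ### The two events at scale `T` and their probabilities. -/

section Events

variable {Ω : Type*} [MeasurableSpace Ω] {μ : Measure Ω} [IsProbabilityMeasure μ] {d : ℕ} {α : ℝ}
  {ξ : (Fin d → ℤ) → Ω → ℝ}

/-- The event that the field exceeds the cone of height `(T / log T)^β Λ`. -/
def coneExceeded (ξ : (Fin d → ℤ) → Ω → ℝ) (β T Λ : ℝ) : Set Ω :=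
  {ω | ∃ z, levelScale β T * Λ + β / 2 * Real.log T / (2 * T) * latticeNorm z < ξ z ω}

/-- The cube of sites reachable at small cost for the level `(T / log T)^β Λ`. -/
noncomputable def reachableCube (d : ℕ) (c β T Λ : ℝ) : Finset (Fin d → ℤ) :=
  latticeCube d (c * (T / Real.log T * (levelScale β T * Λ)))

/-- The event that the field stays below `(T / log T)^β Λ` on the reachable cube. -/
def cubeBelow (ξ : (Fin d → ℤ) → Ω → ℝ) (c β T Λ : ℝ) : Set Ω :=
  {ω | ∀ z ∈ reachableCube d c β T Λ, ξ z ω ≤ levelScale β T * Λ}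

/-- This is where the exponent is fixed: `β (α - d) = d`, so the tail weight of the scale cancels
the volume `(T / log T)^d`. -/
lemma levelScale_rpow_neg (hα : (d : ℝ) < α) {T Λ : ℝ} (hT : 0 < T) (hl : 0 < Real.log T)
    (hΛ : 0 < Λ) : (levelScale (d / (α - d)) T * Λ) ^ (-(α - d))
      = (T / Real.log T) ^ (-(d : ℝ)) * Λ ^ (-(α - d)) := by
  have hs := levelScale_pos (β := d / (α - d)) hT hl
  have hD : α - d ≠ 0 := by linarith
  rw [Real.mul_rpow hs.le hΛ.le, levelScale, ← Real.rpow_mul (div_pos hT hl).le]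
  congr 2
  field_simp

lemma IsParetoField.exists_measure_coneExceeded_le (P : IsParetoField ξ μ α) (hd : 1 ≤ d)
    (hα : (d : ℝ) < α) : ∃ C : ℝ, 0 < C ∧ ∀ᶠ T : ℝ in atTop, ∀ Λ : ℝ, 1 ≤ Λ →
      μ (coneExceeded ξ (d / (α - d)) T Λ) ≤ ENNReal.ofReal (C * Λ ^ (-(α - d))) := by
  obtain ⟨C, hC, h⟩ := P.exists_measure_cone_le hα
  have hd0 : (0 : ℝ) < d := by exact_mod_cast hd
  have hD : 0 < α - d := by linarith
  set β := d / (α - d) with hβdef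
  have hβ : 0 < β := div_pos hd0 hD
  refine ⟨C * (β / 4) ^ (-(d : ℝ)), by positivity, ?_⟩
  filter_upwards [eventually_one_le_log, eventually_gt_atTop 0,
    eventually_mul_log_rpow_le (β / 4) 1 one_pos,
    eventually_mul_log_rpow_le 1 1 one_pos] with T hl hT h1 h2 Λ hΛ
  rw [Real.rpow_one, Real.rpow_one] at h1 h2
  have hl0 : 0 < Real.log T := by linarith
  have hs : 1 ≤ T / Real.log T := by rw [le_div_iff₀ hl0]; exact h2
  have hb : β / 2 * Real.log T / (2 * T) = β / 4 * (T / Real.log T)⁻¹ := by field_simp; ring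
  have hb1 : β / 2 * Real.log T / (2 * T) ≤ levelScale β T * Λ := by
    have e1 : β / 2 * Real.log T / (2 * T) ≤ 1 := by
      rw [div_le_one (by positivity)]; linarith
    have e2 : 1 ≤ levelScale β T := Real.one_le_rpow hs hβ.le
    nlinarith
  refine (h _ _ (by positivity) hb1).trans (ENNReal.ofReal_le_ofReal (le_of_eq ?_))
  rw [levelScale_rpow_neg hα hT hl0 (by linarith), hb, Real.mul_rpow (by positivity) (by positivity),
    Real.inv_rpow (by positivity), ← Real.rpow_neg (by positivity), neg_neg]
  have e3 : (T / Real.log T) ^ (-(d : ℝ)) * (T / Real.log T) ^ (d : ℝ) = 1 := by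
    rw [← Real.rpow_add (by positivity), neg_add_cancel, Real.rpow_zero]
  linear_combination (C * (β / 4) ^ (-(d : ℝ)) * Λ ^ (-(α - d))) * e3

/-- With `x = levelScale β T * Λ`, the cube has about `(T / log T)^d x^d` sites, each exceeding `x`
with probability `x^{-α}`; the expected number of exceedances is thus of order `Λ^{-(α - d)}`. The
lower bound on `Λ` keeps `x ≥ 1`, where the Pareto tail is explicit. -/
lemma eventually_reachableCube (hd : 1 ≤ d) (hα : (d : ℝ) < α) {c : ℝ} (hc : 0 < c) :
    ∀ᶠ T : ℝ in atTop, ∀ Λ : ℝ, (Real.log T)⁻¹ ≤ Λ →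
      1 ≤ levelScale (d / (α - d)) T * Λ ∧
      (c / 4) ^ d * Λ ^ (-(α - d)) ≤ (reachableCube d c (d / (α - d)) T Λ).card *
        (levelScale (d / (α - d)) T * Λ) ^ (-α) := by
  have hd0 : (0 : ℝ) < d := by exact_mod_cast hd
  have hD : 0 < α - d := by linarith
  set β := d / (α - d) with hβdef
  have hβ : 0 < β := div_pos hd0 hD
  filter_upwards [eventually_one_le_log, eventually_gt_atTop 0,
    eventually_mul_log_rpow_le 1 (1 + β) hβ,
    eventually_mul_log_rpow_le (4 / c) 1 one_pos] with T hl hT h1 h2 Λ hΛ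
  have hl0 : 0 < Real.log T := by linarith
  have hs0 : 0 < T / Real.log T := div_pos hT hl0
  have hΛ0 : 0 < Λ := (inv_pos.2 hl0).trans_le hΛ
  have hsc := levelScale_pos (β := β) hT hl0
  have hx : 1 ≤ levelScale β T * Λ := by
    have e1 : Real.log T ≤ levelScale β T := by
      rw [levelScale, Real.div_rpow hT.le hl0.le, le_div_iff₀ (by positivity)]
      rwa [Real.rpow_add hl0, Real.rpow_one, one_mul] at h1
    calc (1 : ℝ) = Real.log T * (Real.log T)⁻¹ := (mul_inv_cancel₀ hl0.ne').symm
      _ ≤ _ := mul_le_mul e1 hΛ (by positivity) hsc.le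
  refine ⟨hx, ?_⟩
  set x := levelScale β T * Λ with hxdef
  have hx0 : 0 < x := by linarith
  have hr : 4 ≤ c * (T / Real.log T * x) := by
    rw [Real.rpow_one, Real.rpow_one] at h2
    have e1 : 4 ≤ c * (T / Real.log T) := by
      rw [← div_le_iff₀' hc, le_div_iff₀ hl0]; exact h2
    calc (4 : ℝ) ≤ c * (T / Real.log T) := e1
      _ ≤ c * (T / Real.log T) * x := le_mul_of_one_le_right (by positivity) hx
      _ = _ := by ring
  refine le_trans (le_of_eq ?_) (mul_le_mul_of_nonneg_right (card_latticeCube_ge (d := d) hr)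
    (by positivity))
  have e2 : x ^ (-α) = x ^ (-(α - d)) * x ^ (-(d : ℝ)) := by
    rw [← Real.rpow_add hx0]; ring_nf
  have e3 : (T / Real.log T) ^ (-(d : ℝ)) * (T / Real.log T) ^ d = 1 := by
    rw [← Real.rpow_natCast, ← Real.rpow_add hs0, neg_add_cancel, Real.rpow_zero]
  have e4 : x ^ (-(d : ℝ)) * x ^ d = 1 := by
    rw [← Real.rpow_natCast, ← Real.rpow_add hx0, neg_add_cancel, Real.rpow_zero]
  rw [e2, hxdef, levelScale_rpow_neg hα hT hl0 hΛ0, ← hxdef,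
    show c * (T / Real.log T * x) / 4 = c / 4 * (T / Real.log T * x) by ring, mul_pow, mul_pow]
  linear_combination (-(c / 4) ^ d * Λ ^ (-(α - d))) * e3 -
    ((c / 4) ^ d * Λ ^ (-(α - d)) * ((T / Real.log T) ^ (-(d : ℝ)) * (T / Real.log T) ^ d)) * e4

lemma IsParetoField.eventually_measure_cubeBelow_le (P : IsParetoField ξ μ α) (hd : 1 ≤ d)
    (hα : (d : ℝ) < α) {c : ℝ} (hc : 0 < c) :
    ∀ᶠ T : ℝ in atTop, ∀ Λ : ℝ, (Real.log T)⁻¹ ≤ Λ →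
      μ (cubeBelow ξ c (d / (α - d)) T Λ)
        ≤ ENNReal.ofReal (Real.exp (-((c / 4) ^ d * Λ ^ (-(α - d))))) := by
  filter_upwards [eventually_reachableCube hd hα hc] with T h Λ hΛ
  obtain ⟨h1, h2⟩ := h Λ hΛ
  refine (P.measure_forall_le (reachableCube d c (d / (α - d)) T Λ) id (Set.injOn_id _)
    (fun _ => levelScale (d / (α - d)) T * Λ) fun _ _ => h1).trans (ENNReal.ofReal_le_ofReal ?_)
  rw [Finset.sum_const, nsmul_eq_mul]
  exact Real.exp_le_exp.2 (neg_le_neg h2)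

/-- The divergence half of the Borel–Cantelli lemma for exceedances on disjoint blocks. -/
lemma IsParetoField.measure_forall_blocks_eq_zero (P : IsParetoField ξ μ α)
    {S : ℕ → Finset (Fin d → ℤ)} (hS : ∀ i j, i < j → ∀ z ∈ S i, z ∉ S j) {x : ℕ → ℝ}
    (hx : ∀ k, 1 ≤ x k) (hsum : ¬ Summable fun k => ((S k).card : ℝ) * x k ^ (-α)) :
    μ {ω | ∀ k, ∀ z ∈ S k, ξ z ω ≤ x k} = 0 := by
  have hx0 : ∀ k, 0 < x k := fun k => zero_lt_one.trans_le (hx k)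
  have hbound : ∀ N : ℕ, μ {ω | ∀ k, ∀ z ∈ S k, ξ z ω ≤ x k}
      ≤ ENNReal.ofReal (Real.exp (-∑ k ∈ Finset.range N, ((S k).card : ℝ) * x k ^ (-α))) := by
    intro N
    -- Disjointness of the blocks makes all sites of the first `N` blocks distinct, so independence
    -- applies to them jointly.
    have hinj : Set.InjOn (fun p : Σ _ : ℕ, (Fin d → ℤ) => p.2)
        ((Finset.range N).sigma S : Finset (Σ _ : ℕ, (Fin d → ℤ))) := by
      rintro ⟨i, z⟩ hi ⟨j, w⟩ hj (rfl : z = w)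
      have hi' := (Finset.mem_sigma.1 (Finset.mem_coe.1 hi)).2
      have hj' := (Finset.mem_sigma.1 (Finset.mem_coe.1 hj)).2
      rcases lt_trichotomy i j with h | rfl | h
      · exact absurd hj' (hS i j h z hi')
      · rfl
      · exact absurd hi' (hS j i h z hj')
    have h := P.measure_forall_le ((Finset.range N).sigma S) (fun p => p.2) hinj
      (fun p => x p.1) fun p _ => hx p.1
    rw [Finset.sum_sigma] at h
    simp only [Finset.sum_const, nsmul_eq_mul] at h
    refine le_trans (measure_mono ?_) h
    intro ω hω p hp
    exact hω p.1 p.2 (Finset.mem_sigma.1 hp).2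
  have hdiv := (not_summable_iff_tendsto_nat_atTop_of_nonneg fun k =>
    mul_nonneg (Nat.cast_nonneg _) (Real.rpow_nonneg (hx0 k).le _)).1 hsum
  have hlim := ENNReal.tendsto_ofReal (Real.tendsto_exp_neg_atTop_nhds_zero.comp hdiv)
  rw [ENNReal.ofReal_zero] at hlim
  exact le_antisymm (ge_of_tendsto' hlim hbound) zero_le

/-- The probability of exceeding the cone of slope `1` and height `n + 1` tends to zero, so almost
surely some height suffices. -/
lemma IsParetoField.ae_exists_hasLinearGrowth (P : IsParetoField ξ μ α) (hα : (d : ℝ) < α) :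
    ∀ᵐ ω ∂μ, ∃ A, HasLinearGrowth (fun z => ξ z ω) A 1 := by
  obtain ⟨C, hC, h⟩ := P.exists_measure_cone_le hα
  have hnull : μ {ω | ∀ n : ℕ, ∃ z, ((n + 1 : ℕ) : ℝ) + 1 * latticeNorm z < ξ z ω} = 0 := by
    have hlim : Tendsto (fun n : ℕ => ENNReal.ofReal (C * (((n + 1 : ℕ) : ℝ) ^ (-(α - d)) *
        1 ^ (-(d : ℝ))))) atTop (𝓝 0) := by
      have h1 := (tendsto_rpow_neg_atTop (y := α - d) (by linarith)).comp
        (tendsto_natCast_atTop_atTop.comp (tendsto_add_atTop_nat 1))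
      have h2 := ENNReal.tendsto_ofReal ((h1.mul_const ((1 : ℝ) ^ (-(d : ℝ)))).const_mul C)
      simpa using h2
    refine le_antisymm (ge_of_tendsto' hlim fun n => ?_) zero_le
    refine (measure_mono fun ω hω => ?_).trans (h ((n + 1 : ℕ) : ℝ) 1 one_pos (by simp))
    exact hω n
  have hae : ∀ᵐ ω ∂μ, ¬ ∀ n : ℕ, ∃ z, ((n + 1 : ℕ) : ℝ) + 1 * latticeNorm z < ξ z ω := by
    rw [ae_iff]
    simpa using hnull
  filter_upwards [hae, P.ae_one_lt] with ω h1 h2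
  push Not at h1
  obtain ⟨n, hn⟩ := h1
  exact ⟨_, Nat.cast_nonneg _, zero_le_one, fun z => by linarith [h2 z], hn⟩

end Events

/-! ### From events on the field to the logarithmic deviation. -/

/-- The logarithmic deviation `log L_t - β log t` of the growth rate of the minimal solution. -/
noncomputable def logDeviation {d : ℕ} (β : ℝ) (V : (Fin d → ℤ) → ℝ) (t : ℝ) : ℝ :=
  Real.log (logMassRate (pathSolution V) t) - β * Real.log t

section Transfer

variable {d : ℕ} {β : ℝ}

lemma eventually_logDeviation_le (hβ : 0 < β) : ∀ᶠ T : ℝ in atTop, ∀ Λ : ℝ, 1 ≤ Λ →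
    ∀ V : (Fin d → ℤ) → ℝ, (∀ z, 1 < V z) →
      (∀ z, V z ≤ levelScale β T * Λ + β / 2 * Real.log T / (2 * T) * latticeNorm z) →
      ∀ t ∈ Set.Icc T (2 * T), logDeviation β V t
        ≤ -(β * Real.log (Real.log t)) + Real.log Λ + (1 + β) * Real.log 2 := by
  filter_upwards [eventually_logMassRate_le (d := d) hβ, eventually_ge_atTop 2,
    eventually_one_le_log] with T h hT hl Λ hΛ V hV1 hV t ht
  have hs := levelScale_pos (β := β) (T := T) (by linarith) (by linarith)
  have G : HasLinearGrowth V (levelScale β T * Λ) (β / 2 * Real.log T / (2 * T)) :=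
    ⟨by positivity, by positivity, fun z => by linarith [hV1 z], hV⟩
  have ht0 : 0 < t := by linarith [ht.1]
  exact log_sub_le_of_le_levelScale hβ hT ht.1 ht.2 (by linarith)
    (zero_lt_one.trans_le (G.le_logMassRate (fun z => (hV1 z).le) ht0)) (h Λ hΛ V G t ht)

lemma eventually_le_logDeviation (hβ : 0 < β) {c : ℝ} (hc : 0 < c)
    (hcd : 8 * (d * (β + 1) * c) ≤ 1) (q : ℝ) :
    ∀ᶠ T : ℝ in atTop, ∀ Λ : ℝ, (Real.log T)⁻¹ ≤ Λ → Λ ≤ Real.log T ^ q →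
      ∀ (V : (Fin d → ℤ) → ℝ) (A B : ℝ), HasLinearGrowth V A B →
      (∃ z ∈ reachableCube d c β T Λ, levelScale β T * Λ < V z) →
      ∀ t ∈ Set.Icc T (2 * T),
        -(β * Real.log (Real.log t)) + Real.log Λ - (Real.log 4 + β * Real.log 2)
          ≤ logDeviation β V t := by
  filter_upwards [eventually_le_logMassRate (d := d) hβ hc hcd q, eventually_ge_atTop 2,
    eventually_one_le_log] with T h hT hl Λ hΛ1 hΛ2 V A B G hz t ht
  have hΛ : 0 < Λ := (inv_pos.2 (by linarith)).trans_le hΛ1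
  exact le_log_sub_of_levelScale_le hβ hT ht.1 ht.2 hΛ (h Λ hΛ1 hΛ2 V A B G hz t ht)

end Transfer

lemma tendsto_log_log_atTop : Tendsto (fun t : ℝ => Real.log (Real.log t)) atTop atTop :=
  Real.tendsto_log_atTop.comp Real.tendsto_log_atTop

lemma tendsto_log_log_log_atTop :
    Tendsto (fun t : ℝ => Real.log (Real.log (Real.log t))) atTop atTop :=
  Real.tendsto_log_atTop.comp tendsto_log_log_atTop

section BorelCantelli

variable {Ω : Type*} [MeasurableSpace Ω] {μ : Measure Ω}

lemma ae_eventually_notMem_of_le {s : ℕ → Set Ω} {f : ℕ → ℝ} (hf : Summable f)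
    (h : ∀ᶠ j in atTop, μ (s j) ≤ ENNReal.ofReal (f j)) : ∀ᵐ ω ∂μ, ∀ᶠ j in atTop, ω ∉ s j := by
  obtain ⟨J, hJ⟩ := eventually_atTop.1 h
  have h1 : ∑' j, μ (if J ≤ j then s j else ∅) ≠ ⊤ := by
    refine ne_top_of_le_ne_top hf.tsum_ofReal_ne_top (ENNReal.tsum_le_tsum fun j => ?_)
    split_ifs with hj
    · exact hJ j hj
    · simp
  filter_upwards [ae_eventually_notMem h1] with ω hω
  filter_upwards [hω, eventually_ge_atTop J] with j h2 h3
  rwa [if_pos h3] at h2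

lemma ae_frequently_notMem_of_tendsto {s : ℕ → Set Ω} (h : Tendsto (fun n => μ (s n)) atTop (𝓝 0)) :
    ∀ᵐ ω ∂μ, ∃ᶠ n in atTop, ω ∉ s n := by
  have h1 : ∀ m : ℕ, μ {ω | ∀ n ≥ m, ω ∈ s n} = 0 := fun m =>
    le_antisymm (ge_of_tendsto h ((eventually_ge_atTop m).mono fun n hn =>
      measure_mono fun ω hω => hω n hn)) zero_le
  have h2 : ∀ᵐ ω ∂μ, ∀ m : ℕ, ¬ ∀ n ≥ m, ω ∈ s n := by
    rw [ae_all_iff]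
    intro m
    rw [ae_iff]
    simpa using h1 m
  filter_upwards [h2] with ω hω
  rw [frequently_atTop]
  intro m
  have := hω m
  push Not at this
  exact this

end BorelCantelli

lemma notMem_coneExceeded {Ω : Type*} {d : ℕ} {ξ : (Fin d → ℤ) → Ω → ℝ} {β T Λ : ℝ} {ω : Ω} (h : ω ∉ coneExceeded ξ β T Λ) (z : Fin d → ℤ) :
    ξ z ω ≤ levelScale β T * Λ + β / 2 * Real.log T / (2 * T) * latticeNorm z := by
  by_contra! hz
  exact h ⟨z, hz⟩

lemma notMem_cubeBelow {Ω : Type*} {d : ℕ} {ξ : (Fin d → ℤ) → Ω → ℝ} {c β T Λ : ℝ} {ω : Ω} (h : ω ∉ cubeBelow ξ c β T Λ) :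
    ∃ z ∈ reachableCube d c β T Λ, levelScale β T * Λ < ξ z ω := by
  by_contra! hz
  exact h hz

/-! ### Almost sure upper envelope. -/

section AlmostSure

variable {Ω : Type*} [MeasurableSpace Ω] {μ : Measure Ω} [IsProbabilityMeasure μ] {d : ℕ} {α : ℝ}
  {ξ : (Fin d → ℤ) → Ω → ℝ}

lemma rpow_one_div_rpow_neg {x D : ℝ} (hx : 0 ≤ x) (hD : 0 < D) : (x ^ (1 / D)) ^ (-D) = x⁻¹ := by
  rw [← Real.rpow_mul hx, show 1 / D * -D = -1 by field_simp, Real.rpow_neg_one]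

/-- Almost sure upper envelope of the growth rate. -/
lemma IsParetoField.exists_ae_eventually_logDeviation_le (P : IsParetoField ξ μ α) (hd : 1 ≤ d)
    (hα : (d : ℝ) < α) {p : ℝ} (hp : 1 < p) :
    ∃ C : ℝ, ∀ᵐ ω ∂μ, ∀ᶠ t : ℝ in atTop,
      logDeviation (d / (α - d)) (fun z => ξ z ω) t
        ≤ -(d / (α - d) * Real.log (Real.log t)) + 1 / (α - d) * Real.log (Real.log t)
          + p / (α - d) * Real.log (Real.log (Real.log t)) + C := by
  have hd0 : (0 : ℝ) < d := by exact_mod_cast hd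
  have hD : 0 < α - d := by linarith
  set D := α - d with hDdef
  set β := d / D with hβdef
  have hβ : 0 < β := div_pos hd0 hD
  obtain ⟨C₀, hC₀, hμ⟩ := P.exists_measure_coneExceeded_le hd hα
  rw [← hDdef, ← hβdef] at hμ
  -- With `Λ = g(j)^{1/D}` the exceedance probability at scale `2^j` is at most a constant times `1
  -- / g(j)`, which is summable exactly for `p > 1`.
  set g : ℕ → ℝ := fun j => (j : ℝ) * (1 + Real.log j) ^ p with hg
  have hg1 : ∀ j : ℕ, 1 ≤ j → 1 ≤ g j := fun j hj => by
    have h1 : (1 : ℝ) ≤ j := by exact_mod_cast hj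
    have h2 := Real.one_le_rpow (one_le_one_add_log_natCast j) (by linarith : 0 ≤ p)
    exact one_le_mul_of_one_le_of_one_le h1 h2
  have hpow : Tendsto (fun j : ℕ => (2 : ℝ) ^ j) atTop atTop :=
    tendsto_pow_atTop_atTop_of_one_lt one_lt_two
  have hbc := ae_eventually_notMem_of_le (μ := μ)
    (s := fun j : ℕ => coneExceeded ξ β (2 ^ j) (g j ^ (1 / D)))
    ((summable_inv_mul_one_add_log_rpow hp).mul_left C₀) (by
      filter_upwards [hpow.eventually hμ, eventually_ge_atTop 1] with j h1 hj
      have h2 := h1 (g j ^ (1 / D)) (Real.one_le_rpow (hg1 j hj) (by positivity))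
      rwa [rpow_one_div_rpow_neg (zero_le_one.trans (hg1 j hj)) hD] at h2)
  refine ⟨1 / D * (Real.log 2 + p * Real.log 3) + (1 + β) * Real.log 2, ?_⟩
  filter_upwards [hbc, P.ae_one_lt] with ω hω h1
  refine (eventually_atTop_of_dyadic (Q := fun t => 1 ≤ Real.log (Real.log t) →
    logDeviation β (fun z => ξ z ω) t ≤ -(β * Real.log (Real.log t)) +
      1 / D * Real.log (Real.log t) + p / D * Real.log (Real.log (Real.log t)) +
      (1 / D * (Real.log 2 + p * Real.log 3) + (1 + β) * Real.log 2)) ?_).mp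
    ((tendsto_log_log_atTop.eventually_ge_atTop 1).mono fun t h2 h => h h2)
  filter_upwards [hω, hpow.eventually (eventually_logDeviation_le (d := d) hβ),
    eventually_ge_atTop 1] with j h2 h3 hj t ht hll
  have h4 := h3 _ (Real.one_le_rpow (hg1 j hj) (by positivity)) _ h1 (notMem_coneExceeded h2) t ht
  have hj0 : (0 : ℝ) < j := by exact_mod_cast hj
  have ht0 : 0 < t := (by positivity : (0 : ℝ) < 2 ^ j).trans_le ht.1
  -- Since `2^j ≤ t`, the index is at most of order `log t`, so `log j` and `log log j` become `log
  -- log t` and `log log log t` up to constants.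
  have hlog1 : (j : ℝ) ≤ 2 * Real.log t := by
    have e1 := Real.log_le_log (by positivity) ht.1
    rw [Real.log_pow] at e1
    have e2 : (1 / 2 : ℝ) ≤ Real.log 2 := by linarith [Real.log_two_gt_d9]
    nlinarith
  have hlt0 : 0 < Real.log t := by linarith
  have hlog2 : Real.log j ≤ Real.log 2 + Real.log (Real.log t) := by
    rw [← Real.log_mul two_ne_zero hlt0.ne']
    exact Real.log_le_log hj0 hlog1
  have hlog3 : Real.log (1 + Real.log j) ≤ Real.log 3 + Real.log (Real.log (Real.log t)) := by
    rw [← Real.log_mul (by norm_num) (by linarith)]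
    refine Real.log_le_log (by linarith [one_le_one_add_log_natCast j]) ?_
    linarith [Real.log_two_lt_d9]
  have hΛ : Real.log (g j ^ (1 / D)) = 1 / D * (Real.log j + p * Real.log (1 + Real.log j)) := by
    have e3 : 0 < 1 + Real.log j := by linarith [one_le_one_add_log_natCast j]
    rw [Real.log_rpow (by linarith [hg1 j hj]), hg, Real.log_mul hj0.ne' (by positivity),
      Real.log_rpow e3]
  rw [hΛ] at h4
  have h5 : 1 / D * (Real.log j + p * Real.log (1 + Real.log j)) ≤ 1 / D * ((Real.log 2 +
      Real.log (Real.log t)) + p * (Real.log 3 + Real.log (Real.log (Real.log t)))) := by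
    gcongr
  have h6 : p / D * Real.log (Real.log (Real.log t))
      = 1 / D * (p * Real.log (Real.log (Real.log t))) := by ring
  rw [h6]
  linarith

/-- Almost surely, the growth rate is large along a sequence of times. -/
lemma IsParetoField.exists_ae_frequently_le_logDeviation (P : IsParetoField ξ μ α) (hd : 1 ≤ d)
    (hα : (d : ℝ) < α) :
    ∃ C : ℝ, ∀ᵐ ω ∂μ, ∃ᶠ t : ℝ in atTop,
      -(d / (α - d) * Real.log (Real.log t)) + 1 / (α - d) * Real.log (Real.log t)
          + 1 / (α - d) * Real.log (Real.log (Real.log t)) - C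
        ≤ logDeviation (d / (α - d)) (fun z => ξ z ω) t := by
  have hd0 : (0 : ℝ) < d := by exact_mod_cast hd
  have hD : 0 < α - d := by linarith
  set D := α - d with hDdef
  set β := d / D with hβdef
  have hβ : 0 < β := div_pos hd0 hD
  set c : ℝ := 1 / (8 * (d * (β + 1))) with hcdef
  have hc : 0 < c := by positivity
  have hcd : 8 * (d * (β + 1) * c) ≤ 1 := le_of_eq (by rw [hcdef]; field_simp)
  set Λ : ℕ → ℝ := fun k => ((k : ℝ) * (1 + Real.log k)) ^ (1 / D) with hΛdef
  -- Powers of `4` rather than `2`: dividing by `log T` costs a factor `k / (k + 1) ≥ 1/2`, and the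
  -- radii must still at least double for the cubes to be disjoint.
  set T : ℕ → ℝ := fun k => 4 ^ k with hTdef
  have hTtop : Tendsto T atTop atTop := tendsto_pow_atTop_atTop_of_one_lt (by norm_num)
  have hlogT : ∀ k, Real.log (T k) = k * Real.log 4 := fun k => Real.log_pow 4 k
  have hlog4 : Real.log 4 = 2 * Real.log 2 := by
    rw [show (4 : ℝ) = 2 ^ 2 by norm_num, Real.log_pow]; norm_num
  have hl1 : 1 ≤ Real.log 4 := by rw [hlog4]; linarith [Real.log_two_gt_d9]
  have hl2 : Real.log 4 ≤ 2 := by rw [hlog4]; linarith [Real.log_two_lt_d9]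
  have hg1 : ∀ k : ℕ, 1 ≤ k → 1 ≤ (k : ℝ) * (1 + Real.log k) := fun k hk =>
    one_le_mul_of_one_le_of_one_le (by exact_mod_cast hk) (one_le_one_add_log_natCast k)
  have hΛ1 : ∀ k : ℕ, 1 ≤ k → 1 ≤ Λ k := fun k hk => Real.one_le_rpow (hg1 k hk) (by positivity)
  have hlogT1 : ∀ k : ℕ, 1 ≤ k → (k : ℝ) ≤ Real.log (T k) := fun k hk => by
    rw [hlogT]; exact le_mul_of_one_le_right (Nat.cast_nonneg k) hl1
  have hlogT1' : ∀ k : ℕ, 1 ≤ k → (1 : ℝ) ≤ Real.log (T k) := fun k hk =>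
    (by exact_mod_cast hk : (1 : ℝ) ≤ k).trans (hlogT1 k hk)
  have hΛlow : ∀ k : ℕ, 1 ≤ k → (Real.log (T k))⁻¹ ≤ Λ k := fun k hk =>
    (inv_le_one_of_one_le₀ (hlogT1' k hk)).trans (hΛ1 k hk)
  -- Here `1 + log k ≤ k`, so `Λ^D ≤ k² ≤ (log T)²`; this is the origin of the exponent `2 / D`.
  have hΛup : ∀ k : ℕ, 1 ≤ k → Λ k ≤ Real.log (T k) ^ (2 / D) := fun k hk => by
    have h1 := hlogT1 k hk
    have hk0 : (0 : ℝ) < k := by exact_mod_cast hk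
    have h2 := Real.log_le_sub_one_of_pos hk0
    rw [show 2 / D = 2 * (1 / D) by ring, Real.rpow_mul (by linarith), Real.rpow_two]
    refine Real.rpow_le_rpow (by linarith [hg1 k hk]) ?_ (by positivity)
    have := one_le_one_add_log_natCast k
    nlinarith
  set r : ℕ → ℝ := fun k => c * (T k / Real.log (T k) * (levelScale β (T k) * Λ k)) with hrdef
  have hr0 : ∀ k : ℕ, 1 ≤ k → 0 ≤ r k := fun k hk => by
    have h1 := hlogT1' k hk
    have hT0 : 0 < T k := by positivity
    have h2 := levelScale_pos (β := β) hT0 (by linarith)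
    have h3 := hΛ1 k hk
    positivity
  have hrstep : ∀ k : ℕ, 1 ≤ k → 2 * r k ≤ r (k + 1) := fun k hk => by
    have h1 := hlogT1' k hk
    have h1' := hlogT1' (k + 1) (by omega)
    have hT0 : 0 < T k := by positivity
    have hT0' : 0 < T (k + 1) := by positivity
    have hk0 : (1 : ℝ) ≤ k := by exact_mod_cast hk
    have e1 : 2 * (T k / Real.log (T k)) ≤ T (k + 1) / Real.log (T (k + 1)) := by
      rw [← mul_div_assoc, div_le_div_iff₀ (by linarith) (by linarith), hlogT, hlogT]
      have e : T (k + 1) = 4 * T k := pow_succ' 4 k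
      rw [e]
      push_cast
      have : 0 < T k * Real.log 4 := by positivity
      nlinarith
    have h0 : 0 ≤ T k / Real.log (T k) := div_nonneg hT0.le (by linarith)
    have e2 : levelScale β (T k) ≤ levelScale β (T (k + 1)) :=
      Real.rpow_le_rpow h0 (by linarith) hβ.le
    have hlogk : Real.log k ≤ Real.log ((k + 1 : ℕ) : ℝ) :=
      Real.log_le_log (by linarith) (by push_cast; linarith)
    have e3 : Λ k ≤ Λ (k + 1) := by
      refine Real.rpow_le_rpow (by linarith [hg1 k hk]) ?_ (by positivity)
      have := one_le_one_add_log_natCast k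
      refine mul_le_mul (by push_cast; linarith) (by linarith) (by linarith) (by positivity)
    have p2 := levelScale_pos (β := β) hT0' (by linarith)
    have p3 := hΛ1 k hk
    have e4 : levelScale β (T k) * Λ k ≤ levelScale β (T (k + 1)) * Λ (k + 1) :=
      mul_le_mul e2 e3 (by linarith) p2.le
    have p1 := levelScale_pos (β := β) hT0 (by linarith)
    calc 2 * r k = c * (2 * (T k / Real.log (T k)) * (levelScale β (T k) * Λ k)) := by
          simp only [hrdef]; ring
      _ ≤ r (k + 1) := by
          refine mul_le_mul_of_nonneg_left (mul_le_mul e1 e4 (by positivity) ?_) hc.le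
          linarith
  have hrlt : ∀ i j : ℕ, 1 ≤ i → i < j → 2 * r i ≤ r j := by
    intro i j hi hij
    induction j, hij using Nat.le_induction with
    | base => exact hrstep i hi
    | succ j hj ih =>
      have := hrstep j (by omega)
      have := hr0 j (by omega)
      linarith
  obtain ⟨k₀, hk₀⟩ := eventually_atTop.1 (hTtop.eventually (eventually_reachableCube hd hα hc))
  have hfreq : ∀ᵐ ω ∂μ, ∃ᶠ k in atTop, ω ∉ cubeBelow ξ c β (T k) (Λ k) := by
    -- Discarding the first `m` blocks, for every `m`, upgrades one exceedance to infinitely many.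
    -- The shift by `k₀ + 1` reaches the range where the estimates hold and excludes `k = 0`.
    have hm : ∀ m : ℕ, ∀ᵐ ω ∂μ, ¬ ∀ k,
        ω ∈ cubeBelow ξ c β (T (k + (m + k₀ + 1))) (Λ (k + (m + k₀ + 1))) := by
      intro m
      have hblock := P.measure_forall_blocks_eq_zero
        (S := fun k => reachableCube d c β (T (k + (m + k₀ + 1))) (Λ (k + (m + k₀ + 1))))
        (x := fun k => levelScale β (T (k + (m + k₀ + 1))) * Λ (k + (m + k₀ + 1)))
        (fun i j hij z hz => latticeCube_disjoint hd (hrlt _ _ (by omega) (by omega)) hz)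
        (fun k => (hk₀ _ (by omega) _ (hΛlow _ (by omega))).1) ?_
      · rw [ae_iff]
        simpa [cubeBelow] using hblock
      · intro hsum
        have hs2 : Summable fun k : ℕ => (c / 4) ^ d *
            (((k + (m + k₀ + 1) : ℕ) : ℝ) * (1 + Real.log ((k + (m + k₀ + 1) : ℕ) : ℝ)))⁻¹ := by
          refine Summable.of_nonneg_of_le (fun k => ?_) (fun k => ?_) hsum
          · have := hg1 (k + (m + k₀ + 1)) (by omega)
            positivity
          · have h1 := (hk₀ (k + (m + k₀ + 1)) (by omega) _ (hΛlow _ (by omega))).2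
            rwa [← hDdef, ← hβdef, rpow_one_div_rpow_neg
              (zero_le_one.trans (hg1 _ (by omega))) hD] at h1
        rw [summable_mul_left_iff (by positivity)] at hs2
        exact not_summable_inv_mul_one_add_log
          ((summable_nat_add_iff (f := fun n : ℕ => ((n : ℝ) * (1 + Real.log n))⁻¹) _).1 hs2)
    filter_upwards [ae_all_iff.2 hm] with ω hω
    rw [frequently_atTop]
    intro m
    have h1 := hω m
    push Not at h1
    obtain ⟨k, hk⟩ := h1
    exact ⟨_, by omega, hk⟩
  refine ⟨1 / D * Real.log 2 + (Real.log 4 + β * Real.log 2), ?_⟩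
  filter_upwards [hfreq, P.ae_exists_hasLinearGrowth hα] with ω hω ⟨A, G⟩
  refine hTtop.frequently ((hω.and_eventually ((hTtop.eventually
    (eventually_le_logDeviation hβ hc hcd (2 / D))).and (eventually_ge_atTop 1))).mono ?_)
  rintro k ⟨h1, h2, hk⟩
  have h3 := h2 _ (hΛlow k hk) (hΛup k hk) _ A 1 G (notMem_cubeBelow h1) (T k)
    ⟨le_rfl, by have : 0 < T k := by positivity
                linarith⟩
  have hk0 : (0 : ℝ) < k := by exact_mod_cast hk
  have e0 := one_le_one_add_log_natCast k
  have hΛlog : Real.log (Λ k) = 1 / D * (Real.log k + Real.log (1 + Real.log k)) := by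
    rw [hΛdef, Real.log_rpow (by linarith [hg1 k hk]), Real.log_mul hk0.ne' (by linarith)]
  have e1 : Real.log (Real.log (T k)) ≤ Real.log k + Real.log 2 := by
    rw [hlogT, ← Real.log_mul hk0.ne' two_ne_zero]
    exact Real.log_le_log (by positivity) (mul_le_mul_of_nonneg_left hl2 hk0.le)
  have e1' : 0 ≤ Real.log (Real.log (T k)) := Real.log_nonneg (hlogT1' k hk)
  have e2 : Real.log (Real.log (Real.log (T k))) ≤ Real.log (1 + Real.log k) := by
    rcases eq_or_lt_of_le e1' with h0 | hpos
    · rw [← h0, Real.log_zero]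
      exact Real.log_nonneg e0
    · exact Real.log_le_log hpos (by linarith [Real.log_two_lt_d9])
  rw [hΛlog] at h3
  have e3 : 1 / D * (Real.log (Real.log (T k)) + Real.log (Real.log (Real.log (T k))))
      ≤ 1 / D * ((Real.log k + Real.log 2) + Real.log (1 + Real.log k)) := by gcongr
  linarith

end AlmostSure

/-- Convergence in distribution requires `L_t` to be a.e. measurable. The integrand is continuous in
time and measurable in `ω`, hence jointly measurable, and integration preserves this. -/
lemma IsParetoField.measurable_pathTerm {Ω : Type*} [MeasurableSpace Ω]
    {μ : Measure Ω} {d : ℕ} {α : ℝ} {ξ : (Fin d → ℤ) → Ω → ℝ} (P : IsParetoField ξ μ α) (n : ℕ) (t : ℝ)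
    (z : Fin d → ℤ) : Measurable fun ω => pathTerm (fun z => ξ z ω) n t z := by
  have hexp : ∀ (z : Fin d → ℤ) (a s : ℝ), Measurable fun ω => Real.exp (a * (ξ z ω - 2 * d) * s) :=
    fun z a s => Real.measurable_exp.comp
      ((((P.measurable z).sub_const _).const_mul a).mul_const s)
  induction n generalizing t z with
  | zero =>
    simp only [pathTerm]
    simpa using (hexp z 1 t).mul_const _
  | succ n ih =>
    simp only [pathTerm]
    have hu : StronglyMeasurable (Function.uncurry fun (s : ℝ) (ω : Ω) =>
        Real.exp (-(ξ z ω - 2 * d) * s) *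
          neighborSum d (pathTerm (fun z => ξ z ω) n s) z) := by
      refine stronglyMeasurable_uncurry_of_continuous_of_stronglyMeasurable (fun ω => ?_)
        fun s => Measurable.stronglyMeasurable ?_
      · exact (by fun_prop : Continuous fun s => Real.exp (-(ξ z ω - 2 * d) * s)).mul
          (continuous_neighborSum (fun y => continuous_pathTerm n y) z)
      · simp only [neighborSum_apply]
        refine Measurable.mul (by simpa using hexp z (-1) s) ?_
        exact Finset.measurable_fun_sum _ fun i _ => (ih s _).add (ih s _)
    refine Measurable.mul (by simpa using hexp z 1 t) ?_
    simp only [intervalIntegral]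
    exact hu.integral_prod_left.measurable.sub hu.integral_prod_left.measurable

/-! ### Lower envelope, and the upper bound with high probability. -/

section LowerEnvelope

variable {Ω : Type*} [MeasurableSpace Ω] {μ : Measure Ω} [IsProbabilityMeasure μ] {d : ℕ} {α : ℝ}
  {ξ : (Fin d → ℤ) → Ω → ℝ}

/-- Lower bound for the growth rate outside events of small probability. -/
lemma IsParetoField.exists_lower_envelope (P : IsParetoField ξ μ α) (hd : 1 ≤ d)
    (hα : (d : ℝ) < α) :
    ∃ (s : ℝ → Set Ω) (C : ℝ),
      (∀ᶠ T : ℝ in atTop, μ (s T) ≤ ENNReal.ofReal (Real.log T ^ (-2 : ℝ))) ∧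
      ∀ᶠ T : ℝ in atTop, ∀ ω ∉ s T, (∃ A, HasLinearGrowth (fun z => ξ z ω) A 1) →
        ∀ t ∈ Set.Icc T (2 * T),
          -(d / (α - d) * Real.log (Real.log t))
              - 1 / (α - d) * Real.log (Real.log (Real.log t)) - C
            ≤ logDeviation (d / (α - d)) (fun z => ξ z ω) t := by
  have hd0 : (0 : ℝ) < d := by exact_mod_cast hd
  have hD : 0 < α - d := by linarith
  set D := α - d with hDdef
  set β := d / D with hβdef
  have hβ : 0 < β := div_pos hd0 hD
  set c : ℝ := 1 / (8 * (d * (β + 1))) with hcdef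
  have hc : 0 < c := by positivity
  have hcd : 8 * (d * (β + 1) * c) ≤ 1 := le_of_eq (by rw [hcdef]; field_simp)
  set K : ℝ := (c / 4) ^ d with hKdef
  have hK : 0 < K := by positivity
  -- Chosen so that `K Λ^{-D} = 2 log log T`: the failure probability becomes `(log T)^{-2}`,
  -- summable along `T = 2^j`, at a cost of only `log log log T` in `log Λ`.
  set Λ : ℝ → ℝ := fun T => ((2 / K * Real.log (Real.log T)) ^ (1 / D))⁻¹ with hΛdef
  have hΛ : ∀ᶠ T : ℝ in atTop, 1 ≤ 2 / K * Real.log (Real.log T) ∧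
      (Real.log T)⁻¹ ≤ Λ T ∧ Λ T ≤ Real.log T ^ (0 : ℝ) := by
    filter_upwards [Real.tendsto_log_atTop.eventually (eventually_mul_log_rpow_le (2 / K) 1 hD),
      eventually_one_le_log,
      (tendsto_log_log_atTop.const_mul_atTop (by positivity : 0 < 2 / K)).eventually_ge_atTop 1]
      with T h1 h2 h3
    rw [Real.rpow_one] at h1
    refine ⟨h3, inv_anti₀ (by positivity) ?_, ?_⟩
    · calc (2 / K * Real.log (Real.log T)) ^ (1 / D) ≤ (Real.log T ^ D) ^ (1 / D) :=
            Real.rpow_le_rpow (by linarith) h1 (by positivity)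
        _ = Real.log T := by
            rw [← Real.rpow_mul (by linarith), mul_one_div_cancel hD.ne', Real.rpow_one]
    · rw [Real.rpow_zero]
      exact inv_le_one_of_one_le₀ (Real.one_le_rpow h3 (by positivity))
  refine ⟨fun T => cubeBelow ξ c β T (Λ T),
    1 / D * Real.log (2 / K) + (Real.log 4 + β * Real.log 2), ?_, ?_⟩
  · filter_upwards [hΛ, P.eventually_measure_cubeBelow_le hd hα hc, eventually_one_le_log]
      with T ⟨h1, h2, _⟩ h3 h4
    refine (h3 _ h2).trans (ENNReal.ofReal_le_ofReal (le_of_eq ?_))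
    rw [← hDdef, Real.inv_rpow (by positivity), rpow_one_div_rpow_neg (by linarith) hD, inv_inv,
      ← hKdef, Real.rpow_def_of_pos (by linarith)]
    congr 1
    field_simp
  · filter_upwards [hΛ, eventually_le_logDeviation hβ hc hcd 0, eventually_gt_atTop 1,
      tendsto_log_log_atTop.eventually_ge_atTop 1, eventually_one_le_log]
      with T ⟨h1, h2, h3⟩ h4 hT hll hl ω hω ⟨A, G⟩ t ht
    have h5 := h4 _ h2 h3 _ A 1 G (notMem_cubeBelow hω) t ht
    have h6 : Real.log (Λ T) = -(1 / D * (Real.log (2 / K) + Real.log (Real.log (Real.log T)))) := by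
      rw [hΛdef, Real.log_inv, Real.log_rpow (by linarith),
        Real.log_mul (by positivity) (by linarith)]
    have h7 : Real.log (Real.log (Real.log T)) ≤ Real.log (Real.log (Real.log t)) :=
      Real.log_le_log (by linarith) (Real.log_le_log (by linarith)
        (Real.log_le_log (by linarith) ht.1))
    have h8 : 1 / D * (Real.log (2 / K) + Real.log (Real.log (Real.log T)))
        ≤ 1 / D * (Real.log (2 / K) + Real.log (Real.log (Real.log t))) := by gcongr
    rw [h6] at h5
    linarith

/-- Almost sure lower envelope of the growth rate. -/
lemma IsParetoField.exists_ae_eventually_le_logDeviation (P : IsParetoField ξ μ α) (hd : 1 ≤ d)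
    (hα : (d : ℝ) < α) :
    ∃ C : ℝ, ∀ᵐ ω ∂μ, ∀ᶠ t : ℝ in atTop,
      -(d / (α - d) * Real.log (Real.log t))
          - 1 / (α - d) * Real.log (Real.log (Real.log t)) - C
        ≤ logDeviation (d / (α - d)) (fun z => ξ z ω) t := by
  obtain ⟨s, C, h1, h2⟩ := P.exists_lower_envelope hd hα
  have hpow : Tendsto (fun j : ℕ => (2 : ℝ) ^ j) atTop atTop :=
    tendsto_pow_atTop_atTop_of_one_lt one_lt_two
  have hsum : Summable fun j : ℕ => Real.log ((2 : ℝ) ^ j) ^ (-2 : ℝ) := by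
    have h3 : Summable fun j : ℕ => (j : ℝ) ^ (-2 : ℝ) * Real.log 2 ^ (-2 : ℝ) :=
      (Real.summable_nat_rpow.2 (by norm_num)).mul_right _
    refine h3.congr fun j => ?_
    rw [Real.log_pow, Real.mul_rpow (Nat.cast_nonneg j) (Real.log_nonneg one_le_two)]
  refine ⟨C, ?_⟩
  filter_upwards [ae_eventually_notMem_of_le hsum (hpow.eventually h1),
    P.ae_exists_hasLinearGrowth hα] with ω hω hG
  refine eventually_atTop_of_dyadic ?_
  filter_upwards [hω, hpow.eventually h2] with j h3 h4 t ht
  exact h4 ω h3 hG t ht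

/-- Upper bound for the growth rate outside events of small probability. -/
lemma IsParetoField.exists_upper_envelope (P : IsParetoField ξ μ α) (hd : 1 ≤ d)
    (hα : (d : ℝ) < α) {ε : ℝ} (hε : 0 < ε) :
    ∃ (s : ℝ → Set Ω) (C : ℝ), Tendsto (fun T => μ (s T)) atTop (𝓝 0) ∧
      ∀ᶠ T : ℝ in atTop, ∀ ω ∉ s T, (∀ z, 1 < ξ z ω) →
        logDeviation (d / (α - d)) (fun z => ξ z ω) T
          ≤ -(d / (α - d) * Real.log (Real.log T)) + ε * Real.log (Real.log T) + C := by
  have hd0 : (0 : ℝ) < d := by exact_mod_cast hd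
  have hD : 0 < α - d := by linarith
  have hβ : 0 < d / (α - d) := div_pos hd0 hD
  obtain ⟨C₀, hC₀, hμ⟩ := P.exists_measure_coneExceeded_le hd hα
  -- With `Λ = (log T)^ε` the failure probability is of order `(log T)^{-ε(α - d)}`. It tends to
  -- zero, which is enough for statements in probability and for the liminf.
  refine ⟨fun T => coneExceeded ξ (d / (α - d)) T (Real.log T ^ ε),
    (1 + d / (α - d)) * Real.log 2, ?_, ?_⟩
  · have h1 : Tendsto (fun T => ENNReal.ofReal (C₀ * (Real.log T ^ (-(ε * (α - d)))))) atTop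
        (𝓝 0) := by
      have h2 := ((tendsto_rpow_neg_atTop (y := ε * (α - d)) (by positivity)).comp
        Real.tendsto_log_atTop).const_mul C₀
      simpa using ENNReal.tendsto_ofReal h2
    refine tendsto_of_tendsto_of_tendsto_of_le_of_le' tendsto_const_nhds h1
      (Eventually.of_forall fun _ => zero_le) ?_
    filter_upwards [hμ, eventually_one_le_log] with T h2 h3
    refine (h2 _ (Real.one_le_rpow h3 hε.le)).trans (le_of_eq ?_)
    rw [← Real.rpow_mul (by linarith), mul_neg]
  · filter_upwards [eventually_logDeviation_le (d := d) hβ, eventually_one_le_log,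
      eventually_ge_atTop 0] with T h1 h2 hT ω hω h3
    have h4 := h1 _ (Real.one_le_rpow h2 hε.le) _ h3 (notMem_coneExceeded hω) T
      ⟨le_rfl, by linarith⟩
    rwa [Real.log_rpow (by linarith)] at h4

lemma IsParetoField.aemeasurable_logMassRate (P : IsParetoField ξ μ α) (hα : (d : ℝ) < α) {t : ℝ}
    (ht : 0 ≤ t) : AEMeasurable (fun ω => logMassRate (pathSolution fun z => ξ z ω) t) μ := by
  have h : AEMeasurable (fun ω => totalMass (pathSolution fun z => ξ z ω) t) μ := by
    refine aemeasurable_of_tendsto_metrizable_ae (u := atTop)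
      (f := fun (s : Finset (ℕ × (Fin d → ℤ))) ω => ∑ p ∈ s, pathTerm (fun z => ξ z ω) p.1 t p.2)
      (fun s => (Finset.measurable_fun_sum s fun p _ =>
        P.measurable_pathTerm p.1 t p.2).aemeasurable) ?_
    filter_upwards [P.ae_exists_hasLinearGrowth hα] with ω ⟨A, G⟩
    exact G.hasSum_pathTerm_prod ht
  exact (Real.measurable_log.comp_aemeasurable h).const_mul _

end LowerEnvelope

/-! ### From envelopes to limsup and liminf. -/

section Limits

lemma eventually_mul_log_add_le (a C : ℝ) {ε : ℝ} (hε : 0 < ε) :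
    ∀ᶠ y : ℝ in atTop, a * Real.log y + C ≤ ε * y := by
  filter_upwards [eventually_mul_log_rpow_le (2 * a / ε) 1 one_pos,
    eventually_ge_atTop (2 * C / ε)] with y h1 h2
  rw [Real.rpow_one, Real.rpow_one, div_mul_eq_mul_div, div_le_iff₀ hε] at h1
  rw [div_le_iff₀ hε] at h2
  linarith

lemma limsup_coe_eq {f : ℝ → ℝ} {a : ℝ} (h1 : ∀ ε > 0, ∀ᶠ t in atTop, f t ≤ a + ε)
    (h2 : ∀ ε > 0, ∃ᶠ t in atTop, a - ε ≤ f t) :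
    limsup (fun t => ((f t : ℝ) : EReal)) atTop = (a : EReal) := by
  refine le_antisymm (EReal.le_of_forall_lt_iff_le.1 fun z hz => ?_)
    (EReal.ge_of_forall_gt_iff_ge.1 fun z hz => ?_)
  · have hz' : a < z := by exact_mod_cast hz
    refine limsup_le_of_le (by isBoundedDefault) ((h1 (z - a) (by linarith)).mono fun t ht => ?_)
    exact_mod_cast (by linarith : f t ≤ z)
  · have hz' : z < a := by exact_mod_cast hz
    refine le_limsup_of_frequently_le ((h2 (a - z) (by linarith)).mono fun t ht => ?_)
      (by isBoundedDefault)
    exact_mod_cast (by linarith : z ≤ f t)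

lemma liminf_coe_eq {f : ℝ → ℝ} {a : ℝ} (h1 : ∀ ε > 0, ∀ᶠ t in atTop, a - ε ≤ f t)
    (h2 : ∀ ε > 0, ∃ᶠ t in atTop, f t ≤ a + ε) :
    liminf (fun t => ((f t : ℝ) : EReal)) atTop = (a : EReal) := by
  refine le_antisymm (EReal.le_of_forall_lt_iff_le.1 fun z hz => ?_)
    (EReal.ge_of_forall_gt_iff_ge.1 fun z hz => ?_)
  · have hz' : a < z := by exact_mod_cast hz
    refine liminf_le_of_frequently_le ((h2 (z - a) (by linarith)).mono fun t ht => ?_)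
      (by isBoundedDefault)
    exact_mod_cast (by linarith : f t ≤ z)
  · have hz' : z < a := by exact_mod_cast hz
    refine le_liminf_of_le (by isBoundedDefault) ((h1 (a - z) (by linarith)).mono fun t ht => ?_)
    exact_mod_cast (by linarith : z ≤ f t)

end Limits

/-! ### The limit theorems for the path solution. -/

section Main

variable {Ω : Type*} [MeasurableSpace Ω] {μ : Measure Ω} [IsProbabilityMeasure μ] {d : ℕ} {α : ℝ}
  {ξ : (Fin d → ℤ) → Ω → ℝ}

lemma IsParetoField.ae_limsup_log_log (P : IsParetoField ξ μ α) (hd : 1 < d) (hα : (d : ℝ) < α) :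
    ∀ᵐ ω ∂μ, limsup (fun t : ℝ => ((logDeviation (d / (α - d)) (fun z => ξ z ω) t /
      Real.log (Real.log t) : ℝ) : EReal)) atTop = ((-(((d : ℝ) - 1) / (α - d)) : ℝ) : EReal) := by
  -- Any `p > 1` would do, since the `log log log t` term is negligible at this scale.
  obtain ⟨C₁, h1⟩ := P.exists_ae_eventually_logDeviation_le hd.le hα one_lt_two
  obtain ⟨C₂, h2⟩ := P.exists_ae_frequently_le_logDeviation hd.le hα
  have hD : 0 < α - d := by linarith
  have e : -(((d : ℝ) - 1) / (α - d)) = -(d / (α - d)) + 1 / (α - d) := by ring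
  filter_upwards [h1, h2] with ω hω1 hω2
  refine limsup_coe_eq (fun ε hε => ?_) fun ε hε => ?_
  · filter_upwards [hω1, tendsto_log_log_atTop.eventually
      (eventually_mul_log_add_le (2 / (α - d)) C₁ hε), tendsto_log_log_atTop.eventually_ge_atTop 1]
      with t h3 h4 h5
    rw [div_le_iff₀ (by linarith), e]
    linarith
  · refine (hω2.and_eventually ((tendsto_log_log_atTop.eventually
      (eventually_mul_log_add_le 0 C₂ hε)).and
      (tendsto_log_log_atTop.eventually_ge_atTop 1))).mono ?_
    rintro t ⟨h3, h4, h5⟩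
    rw [le_div_iff₀ (by linarith), e]
    have h6 : 0 ≤ 1 / (α - d) * Real.log (Real.log (Real.log t)) :=
      mul_nonneg (by positivity) (Real.log_nonneg h5)
    linarith

lemma IsParetoField.ae_limsup_log_log_log (P : IsParetoField ξ μ α) (hd : d = 1)
    (hα : (d : ℝ) < α) :
    ∀ᵐ ω ∂μ, limsup (fun t : ℝ => ((logDeviation (d / (α - d)) (fun z => ξ z ω) t /
      Real.log (Real.log (Real.log t)) : ℝ) : EReal)) atTop = ((1 / (α - d) : ℝ) : EReal) := by
  have hD : 0 < α - d := by linarith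
  -- The coefficient of `log log log t` now matters, so `p` must approach `1`; a sequence of values
  -- keeps the exceptional set null.
  have h1 : ∀ᵐ ω ∂μ, ∀ n : ℕ, ∃ C : ℝ, ∀ᶠ t : ℝ in atTop,
      logDeviation (d / (α - d)) (fun z => ξ z ω) t
        ≤ -(d / (α - d) * Real.log (Real.log t)) + 1 / (α - d) * Real.log (Real.log t)
          + (1 + 1 / ((n : ℝ) + 1)) / (α - d) * Real.log (Real.log (Real.log t)) + C := by
    rw [ae_all_iff]
    intro n
    obtain ⟨C, h⟩ := P.exists_ae_eventually_logDeviation_le hd.ge hα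
      (p := 1 + 1 / ((n : ℝ) + 1)) (lt_add_of_pos_right 1 Nat.one_div_pos_of_nat)
    exact h.mono fun ω hω => ⟨C, hω⟩
  obtain ⟨C₂, h2⟩ := P.exists_ae_frequently_le_logDeviation hd.ge hα
  -- For `d = 1` the two `log log t` terms of the envelopes cancel.
  have e : (d : ℝ) / (α - d) = 1 / (α - d) := by rw [hd]; simp
  filter_upwards [h1, h2] with ω hω1 hω2
  refine limsup_coe_eq (fun ε hε => ?_) fun ε hε => ?_
  · obtain ⟨n, hn⟩ := exists_nat_one_div_lt (show 0 < ε / 2 * (α - d) by positivity)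
    obtain ⟨C, hC⟩ := hω1 n
    filter_upwards [hC, tendsto_log_log_log_atTop.eventually
      (eventually_mul_log_add_le 0 C (half_pos hε)),
      tendsto_log_log_log_atTop.eventually_ge_atTop 1] with t h3 h4 h5
    rw [e] at h3 ⊢
    rw [div_le_iff₀ (by linarith)]
    have h6 : (1 + 1 / ((n : ℝ) + 1)) / (α - d) ≤ 1 / (α - d) + ε / 2 := by
      rw [add_div]
      have := (div_lt_iff₀ hD).2 hn
      linarith
    have h7 := mul_le_mul_of_nonneg_right h6 (zero_le_one.trans h5)
    linarith
  · refine (hω2.and_eventually ((tendsto_log_log_log_atTop.eventually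
      (eventually_mul_log_add_le 0 C₂ hε)).and
      (tendsto_log_log_log_atTop.eventually_ge_atTop 1))).mono ?_
    rintro t ⟨h3, h4, h5⟩
    rw [e] at h3 ⊢
    rw [le_div_iff₀ (by linarith)]
    linarith

lemma IsParetoField.ae_liminf_log_log (P : IsParetoField ξ μ α) (hd : 1 ≤ d) (hα : (d : ℝ) < α) :
    ∀ᵐ ω ∂μ, liminf (fun t : ℝ => ((logDeviation (d / (α - d)) (fun z => ξ z ω) t /
      Real.log (Real.log t) : ℝ) : EReal)) atTop = ((-((d : ℝ) / (α - d)) : ℝ) : EReal) := by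
  have hD : 0 < α - d := by linarith
  obtain ⟨C₁, h1⟩ := P.exists_ae_eventually_le_logDeviation hd hα
  have h2 : ∀ᵐ ω ∂μ, ∀ n : ℕ, ∃ C : ℝ, ∃ᶠ t : ℝ in atTop,
      logDeviation (d / (α - d)) (fun z => ξ z ω) t ≤ -(d / (α - d) * Real.log (Real.log t)) +
        1 / ((n : ℝ) + 1) * Real.log (Real.log t) + C := by
    rw [ae_all_iff]
    intro n
    obtain ⟨s, C, h3, h4⟩ := P.exists_upper_envelope hd hα
      (ε := 1 / ((n : ℝ) + 1)) Nat.one_div_pos_of_nat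
    -- An upper bound on the liminf needs only a sequence of good times. Bad events whose
    -- probabilities tend to zero almost surely fail infinitely often, without any summability.
    filter_upwards [ae_frequently_notMem_of_tendsto (h3.comp tendsto_natCast_atTop_atTop),
      P.ae_one_lt] with ω h5 h6
    refine ⟨C, tendsto_natCast_atTop_atTop.frequently
      ((h5.and_eventually (tendsto_natCast_atTop_atTop.eventually h4)).mono ?_)⟩
    exact fun k hk => hk.2 ω hk.1 h6
  filter_upwards [h1, h2] with ω hω1 hω2
  refine liminf_coe_eq (fun ε hε => ?_) fun ε hε => ?_
  · filter_upwards [hω1, tendsto_log_log_atTop.eventually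
      (eventually_mul_log_add_le (1 / (α - d)) C₁ hε), tendsto_log_log_atTop.eventually_ge_atTop 1]
      with t h3 h4 h5
    rw [le_div_iff₀ (by linarith)]
    linarith
  · obtain ⟨n, hn⟩ := exists_nat_one_div_lt (half_pos hε)
    obtain ⟨C, hC⟩ := hω2 n
    refine (hC.and_eventually ((tendsto_log_log_atTop.eventually
      (eventually_mul_log_add_le 0 C (half_pos hε))).and
      (tendsto_log_log_atTop.eventually_ge_atTop 1))).mono ?_
    rintro t ⟨h3, h4, h5⟩
    rw [div_le_iff₀ (by linarith)]
    have h6 := mul_le_mul_of_nonneg_right hn.le (zero_le_one.trans h5)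
    linarith

/-- The normalised logarithmic deviation converges in probability. -/
lemma IsParetoField.tendstoInMeasure_logDeviation (P : IsParetoField ξ μ α) (hd : 1 ≤ d)
    (hα : (d : ℝ) < α) :
    TendstoInMeasure μ (fun (t : ℝ) ω => logDeviation (d / (α - d)) (fun z => ξ z ω) t /
      Real.log (Real.log t)) atTop (fun _ => -((d : ℝ) / (α - d))) := by
  have hD : 0 < α - d := by linarith
  rw [tendstoInMeasure_iff_norm]
  intro ε hε
  obtain ⟨s, C, hs, hC⟩ := P.exists_upper_envelope hd hα (ε := ε / 4) (by positivity)
  obtain ⟨s', C', hs', hC'⟩ := P.exists_lower_envelope hd hα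
  have hlow : Tendsto (fun T => μ (s' T)) atTop (𝓝 0) := by
    have h1 : Tendsto (fun T => ENNReal.ofReal (Real.log T ^ (-2 : ℝ))) atTop (𝓝 0) := by
      simpa using ENNReal.tendsto_ofReal
        ((tendsto_rpow_neg_atTop (y := 2) two_pos).comp Real.tendsto_log_atTop)
    exact tendsto_of_tendsto_of_tendsto_of_le_of_le' tendsto_const_nhds h1
      (Eventually.of_forall fun _ => zero_le) hs'
  have hsum := hs.add hlow
  rw [add_zero] at hsum
  refine tendsto_of_tendsto_of_tendsto_of_le_of_le' tendsto_const_nhds hsum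
    (Eventually.of_forall fun _ => zero_le) ?_
  filter_upwards [hC, hC', eventually_ge_atTop 0, tendsto_log_log_atTop.eventually_ge_atTop 1,
    tendsto_log_log_atTop.eventually (eventually_mul_log_add_le 0 C (by positivity : 0 < ε / 4)),
    tendsto_log_log_atTop.eventually
      (eventually_mul_log_add_le (1 / (α - d)) C' (by positivity : 0 < ε / 2))]
    with T h1 h2 hT hll h3 h4
  refine le_trans (measure_mono_ae ?_) (measure_union_le (s T) (s' T))
  filter_upwards [P.ae_one_lt, P.ae_exists_hasLinearGrowth hα] with ω h5 h6 h7
  by_contra! hmem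
  have h8 := h1 ω (fun h => hmem (Or.inl h)) h5
  have h9 := h2 ω (fun h => hmem (Or.inr h)) h6 T ⟨le_rfl, by linarith⟩
  have h10 : |logDeviation (d / (α - d)) (fun z => ξ z ω) T / Real.log (Real.log T) -
      -((d : ℝ) / (α - d))| ≤ ε / 2 := by
    rw [abs_le]
    constructor
    · have h11 : -((d : ℝ) / (α - d)) - ε / 2
          ≤ logDeviation (d / (α - d)) (fun z => ξ z ω) T / Real.log (Real.log T) := by
        rw [le_div_iff₀ (by linarith)]
        linarith
      linarith
    · rw [sub_le_iff_le_add, div_le_iff₀ (by linarith)]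
      linarith
  have h11 : ε ≤ |logDeviation (d / (α - d)) (fun z => ξ z ω) T / Real.log (Real.log T) -
      -((d : ℝ) / (α - d))| := h7
  linarith

end Main

theorem theorem1p1 {Ω : Type*} [MeasurableSpace Ω] (μ : Measure Ω) [IsProbabilityMeasure μ]
    (d : ℕ) (hd : 1 ≤ d) (α : ℝ) (hα : (d : ℝ) < α)
    (ξ : (Fin d → ℤ) → Ω → ℝ)
    (hmeas : ∀ z, Measurable (ξ z))
    (hindep : iIndepFun ξ μ)
    (hident : ∀ z, IdentDistrib (ξ z) (ξ 0) μ μ)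
    (hpareto : ∀ x : ℝ, 1 ≤ x → μ.real {ω | ξ 0 ω ≤ x} = 1 - x ^ (-α)) :
    -- almost surely there is exactly one nonnegative solution
    (∀ᵐ ω ∂μ, ∃ v, IsNonnegPAMSolution (fun z => ξ z ω) v ∧
      ∀ w, IsNonnegPAMSolution (fun z => ξ z ω) w → ∀ t : ℝ, 0 ≤ t → w t = v t) ∧
    -- the asymptotics of its total mass
    ∀ u : Ω → ℝ → (Fin d → ℤ) → ℝ,
      (∀ᵐ ω ∂μ, IsNonnegPAMSolution (fun z => ξ z ω) (u ω)) →
      -- `U(t)` is finite and `log L_t` is meaningful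
      (∀ᵐ ω ∂μ, ∀ t : ℝ, 0 < t → Summable (u ω t) ∧ 0 < logMassRate (u ω) t) ∧
      (1 < d → ∀ᵐ ω ∂μ,
        limsup (fun t : ℝ =>
          (((Real.log (logMassRate (u ω) t) - (d : ℝ) / (α - d) * Real.log t) /
            Real.log (Real.log t) : ℝ) : EReal)) atTop
          = ((-(((d : ℝ) - 1) / (α - d)) : ℝ) : EReal)) ∧
      (d = 1 → ∀ᵐ ω ∂μ,
        limsup (fun t : ℝ =>
          (((Real.log (logMassRate (u ω) t) - (d : ℝ) / (α - d) * Real.log t) /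
            Real.log (Real.log (Real.log t)) : ℝ) : EReal)) atTop
          = ((1 / (α - d) : ℝ) : EReal)) ∧
      (∀ᵐ ω ∂μ,
        liminf (fun t : ℝ =>
          (((Real.log (logMassRate (u ω) t) - (d : ℝ) / (α - d) * Real.log t) /
            Real.log (Real.log t) : ℝ) : EReal)) atTop
          = ((-((d : ℝ) / (α - d)) : ℝ) : EReal)) ∧
      TendstoInDistribution
        (fun (t : Set.Ioi (0 : ℝ)) (ω : Ω) =>
          (Real.log (logMassRate (u ω) t) - (d : ℝ) / (α - d) * Real.log t) /
            Real.log (Real.log t))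
        atTop (fun _ : Ω => -((d : ℝ) / (α - d))) (fun _ => μ) μ := by
  have P : IsParetoField ξ μ α := by
    refine ⟨hmeas, hindep, fun z x hx => ?_⟩
    rw [← hpareto x hx]
    exact congrArg ENNReal.toReal ((hident z).measure_mem_eq measurableSet_Iic)
  refine ⟨?_, fun u hu => ?_⟩
  · filter_upwards [P.ae_exists_hasLinearGrowth hα] with ω ⟨A, G⟩
    exact ⟨_, G.pathSolution_isNonnegPAMSolution, fun w hw t ht => G.eq_pathSolution hw ht⟩
  -- Uniqueness transfers every assertion to the path solution, which is also what provides
  -- measurability in `ω`.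
  have hrate : ∀ᵐ ω ∂μ, ∀ t : ℝ, 0 < t →
      logMassRate (u ω) t = logMassRate (pathSolution fun z => ξ z ω) t := by
    filter_upwards [hu, P.ae_exists_hasLinearGrowth hα] with ω hω ⟨A, G⟩ t ht
    rw [logMassRate, logMassRate, totalMass, totalMass, G.eq_pathSolution hω ht.le]
  have hcongr : ∀ᵐ ω ∂μ, ∀ t : ℝ, 0 < t →
      Real.log (logMassRate (u ω) t) - (d : ℝ) / (α - d) * Real.log t
        = logDeviation (d / (α - d)) (fun z => ξ z ω) t :=
    hrate.mono fun ω hω t ht => by rw [hω t ht, logDeviation]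
  refine ⟨?_, fun hd1 => ?_, fun hd1 => ?_, ?_, ?_⟩
  · filter_upwards [hu, hrate, P.ae_exists_hasLinearGrowth hα, P.ae_one_lt]
      with ω h1 h2 ⟨A, G⟩ h3 t ht
    rw [h2 t ht, G.eq_pathSolution h1 ht.le]
    exact ⟨G.summable_pathSolution ht.le,
      zero_lt_one.trans_le (G.le_logMassRate (fun z => (h3 z).le) ht)⟩
  · filter_upwards [hcongr, P.ae_limsup_log_log hd1 hα] with ω h1 h2
    rw [← h2]
    exact limsup_congr ((eventually_gt_atTop 0).mono fun t ht => by rw [h1 t ht])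
  · filter_upwards [hcongr, P.ae_limsup_log_log_log hd1 hα] with ω h1 h2
    rw [← h2]
    exact limsup_congr ((eventually_gt_atTop 0).mono fun t ht => by rw [h1 t ht])
  · filter_upwards [hcongr, P.ae_liminf_log_log hd hα] with ω h1 h2
    rw [← h2]
    exact liminf_congr ((eventually_gt_atTop 0).mono fun t ht => by rw [h1 t ht])
  -- Only positive times are indexed: the values of `u` at negative times are unconstrained and need
  -- not be measurable in `ω`.
  · have hval : Tendsto ((↑) : Set.Ioi (0 : ℝ) → ℝ) atTop atTop := by
      rw [atTop_Ioi_eq]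
      exact tendsto_comap
    have hcg : (atTop : Filter (Set.Ioi (0 : ℝ))).IsCountablyGenerated := by
      rw [atTop_Ioi_eq]
      infer_instance
    refine TendstoInMeasure.tendstoInDistribution ?_ fun t => ?_
    · refine ((P.tendstoInMeasure_logDeviation hd hα).comp hval).congr_left fun t => ?_
      filter_upwards [hcongr] with ω hω
      rw [hω t t.2]
      rfl
    · have h1 : AEMeasurable (fun ω => logMassRate (u ω) t) μ :=
        (P.aemeasurable_logMassRate hα (t := t) t.2.le).congr
          (hrate.mono fun ω hω => (hω t t.2).symm)
      exact ((Real.measurable_log.comp_aemeasurable h1).sub_const _).div_const _
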